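/- **Setting.** Let $m\ge 1$, and consider $$\min_{x=(x_1,\dots,x_m)}\ \Phi(x)=\sum_{i=1}^m \big(f_i(x_i)+h_i(x_i)\big)\quad\text{subject to}\quad Ax=\sum_{i=1}^m A_ix_i=b,$$ where $x_i\in\mathbb R^{n_i}$, $b\in\mathbb R^N$, each $f_i:\mathbb R^{n_i}\to\mathbb R$ is convex and differentiable with Lipschitz continuous gradient, each $h_i:\mathbb R^{n_i}\to\mathbb R\cup\{\infty\}$ is proper, closed and convex, and each $A_i\in\mathbb R^{N\times n_i}$ has linearly independent columns. Let $\mathcal W^*$ be the set of pairs $(x^*,\lambda^*)$ such that $x^*$ solves the problem and $\mathcal L(\cdot,\lambda^*)$ attains its minimum at $x^*$, where $\mathcal L(x,\lambda)=\Phi(x)+\langle\lambda,Ax-b\rangle$. Assume $\mathcal W^*\neq\emptyset$. Norms are Euclidean, and $x_+=(x_2,\dots,x_m)$. Let $M$ be the block lower triangular matrix with blocks $A_{i+1}^{\sf T}A_{j+1}$ for $1\le j\le i<m$ and $0$ for $i<j$, and $H$ the block diagonal matrix with the same diagonal blocks as $M$. **Accelerated BOSVS.** Fix $\rho,\theta_1,\theta_2,\theta_3>0$,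 $\sigma,\alpha\in(0,1)$, and $\psi:[0,\infty)\to[0,\infty)$ with $\psi(0)=0$, $\psi(s)>0$ for $s>0$, and $\psi$ continuous at $0$; let $\psi(\infty)\in(0,\infty]$ be arbitrary. Choose $x^1$ and $\lambda^1$, and set $y^1=x^1$, $\Gamma_i^0=0$, $e^0=\infty$. For $k=1,2,\dots$: 1. For $i=1,\dots,m$, put $b_i^k=b-\sum_{j<i}A_jz_j^k-\sum_{j>i}A_jy_j^k$ and run the following inner loop, whose quantities all depend on $(i,k)$. Start with $a^0=u^0=x_i^k$. Take parameters $\delta^l>0$ $(l\ge1)$, $\alpha^1=1$ and $\alpha^l\in(0,1)$ $(l\ge 2)$, and put $\gamma^l=\frac1{\delta^1}\prod_{j=2}^l(1-\alpha^j)^{-1}$. For $l=1,2,\dots$ set $$\bar a^l=(1-\alpha^l)a^{l-1}+\alpha^lu^{l-1},\qquad a^l=(1-\alpha^l)a^{l-1}+\alpha^lu^{l},$$ $$u^l=\arg\min_u\ \langle\nabla f_i(\bar a^l),u\rangle+\tfrac{\delta^l}{2}\|u-u^{l-1}\|^2+\tfrac{\rho}{2}\|A_iu-b_i^k+\lambda^k/\rho\|^2+h_i(u),$$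 where the parameters are such that $$f_i(\bar a^l)+\langle\nabla f_i(\bar a^l),a^l-\bar a^l\rangle+\tfrac{(1-\sigma)\delta^l}{2\alpha^l}\|a^l-\bar a^l\|^2\ge f_i(a^l).$$ Stop at the first $l\ge1$ with $\gamma^l\ge\Gamma_i^{k-1}$ and $\|a^l-a^{l-1}\|\le\psi(e^{k-1})$. With this $l$, set $x_i^{k+1}=u^l$, $z_i^k=a^l$, $\Gamma_i^k=\gamma^l$, $r_i^k=\frac1{\Gamma_i^k}\sum_{j=1}^l\|u^j-u^{j-1}\|^2$. 2. Set $e^k=\theta_1\|z_+^k-y_+^k\|+\theta_2\|Az^k-b\|+\theta_3\sqrt{\sum_{i=1}^m r_i^k}$. 3. Set $y_1^{k+1}=z_1^k$, $\ y_+^{k+1}=y_+^k+\alpha M^{-\sf T}H(z_+^k-y_+^k)$, $\ \lambda^{k+1}=\lambda^k+\alpha\rho(Az^k-b)$. **Theorem.** Suppose that in every inner loop $\xi^l:=\delta^l\alpha^l\gamma^l=1$ for each $l\ge 1$ and $\gamma^l\to\infty$ as $l\to\infty$, and that there is a constant $\kappa>0$, the same for all inner loops, such that $\gamma^l(\alpha^l)^2\ge\kappa$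 for all $l\ge 1$. If accelerated BOSVS performs an infinite number of iterations, generating $y^k,z^k,\lambda^k$, then $y^k$ and $z^k$ converge to a common limit $x^*$ and $\lambda^k$ converges to a limit $\lambda^*$, where $(x^*,\lambda^*)\in\mathcal W^*$. -/

import Mathlib

open Filter Topology
open scoped ENNReal Matrix

noncomputable section

namespace BOSVS

/-- A proper closed convex function with values in `ℝ ∪ {∞}`: never `-∞`, not identically `∞`,
lower semicontinuous, and with convex epigraph. -/
structure ProperClosedConvex {E : Type*} [NormedAddCommGroup E] [NormedSpace ℝ E]
    (h : E → EReal) : Prop where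
  ne_bot : ∀ u, h u ≠ ⊥
  proper : ∃ u, h u ≠ ⊤
  closed : LowerSemicontinuous h
  convex : Convex ℝ {p : E × ℝ | h p.1 ≤ (p.2 : EReal)}

/-- The data of `min ∑ i, f i (x i) + h i (x i)` subject to `∑ i, A i x i = b`.
There are `m + 1 ≥ 1` blocks, indexed from `0`. -/
structure Problem (m N : ℕ) (n : Fin (m + 1) → ℕ) where
  f : (i : Fin (m + 1)) → EuclideanSpace ℝ (Fin (n i)) → ℝ
  h : (i : Fin (m + 1)) → EuclideanSpace ℝ (Fin (n i)) → EReal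
  A : (i : Fin (m + 1)) → Matrix (Fin N) (Fin (n i)) ℝ
  b : EuclideanSpace ℝ (Fin N)

/-- Vectors `x = (x 0, …, x m)` partitioned into blocks. -/
abbrev Blocks {m : ℕ} (n : Fin (m + 1) → ℕ) : Type :=
  (i : Fin (m + 1)) → EuclideanSpace ℝ (Fin (n i))

namespace Problem

variable {m N : ℕ} {n : Fin (m + 1) → ℕ} (P : Problem m N n)

/-- The product `A_i v`. -/
def mulA (i : Fin (m + 1)) (v : EuclideanSpace ℝ (Fin (n i))) : EuclideanSpace ℝ (Fin N) :=
  Matrix.toEuclideanLin (P.A i) v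

/-- `A x - b`. -/
def residual (x : Blocks n) : EuclideanSpace ℝ (Fin N) :=
  ∑ i, P.mulA i (x i) - P.b

/-- The objective `Φ`. -/
def objective (x : Blocks n) : EReal :=
  ∑ i, ((P.f i (x i) : EReal) + P.h i (x i))

/-- The Lagrangian `Φ(x) + ⟨lam, A x - b⟩`. -/
def lagrangian (x : Blocks n) (lam : EuclideanSpace ℝ (Fin N)) : EReal :=
  P.objective x + ((inner ℝ lam (P.residual x) : ℝ) : EReal)

/-- Convex `f i` with Lipschitz gradient, proper closed convex `h i`, and
linearly independent columns of every `A i`. -/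
structure Standing : Prop where
  f_convex : ∀ i, ConvexOn ℝ Set.univ (P.f i)
  f_diff : ∀ i, Differentiable ℝ (P.f i)
  f_lip : ∀ i, ∃ ζ : NNReal, LipschitzWith ζ (gradient (P.f i))
  h_pcc : ∀ i, ProperClosedConvex (P.h i)
  A_indep : ∀ i, LinearIndependent ℝ (P.A i).col

/-- `x` is feasible and minimizes the objective over the feasible set. -/
def IsSolution (x : Blocks n) : Prop :=
  P.residual x = 0 ∧ ∀ w : Blocks n, P.residual w = 0 → P.objective x ≤ P.objective w

/-- The set of solution/multiplier pairs `(x, lam)`: `x` solves the problem and the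
Lagrangian with multiplier `lam` attains its minimum at `x`. -/
def solutionMultiplierPairs : Set (Blocks n × EuclideanSpace ℝ (Fin N)) :=
  {p | P.IsSolution p.1 ∧ ∀ w : Blocks n, P.lagrangian p.1 p.2 ≤ P.lagrangian w p.2}

/-- The block lower triangular matrix `M`, with blocks `A_iᵀ A_j` for `j ≤ i`, where
`i`, `j` range over all blocks but the first. -/
def M : Matrix (Σ i : Fin m, Fin (n i.succ)) (Σ i : Fin m, Fin (n i.succ)) ℝ :=
  Matrix.of fun p q =>
    if q.1 ≤ p.1 then ((P.A p.1.succ)ᵀ * P.A q.1.succ) p.2 q.2 else 0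

/-- The block diagonal matrix `H` with the same diagonal blocks as `M`. -/
def H : Matrix (Σ i : Fin m, Fin (n i.succ)) (Σ i : Fin m, Fin (n i.succ)) ℝ :=
  Matrix.blockDiagonal' fun i : Fin m => (P.A i.succ)ᵀ * P.A i.succ

/-- `b - ∑_{j < i} A_j z_j - ∑_{j > i} A_j y_j`. -/
def blockRhs (i : Fin (m + 1)) (z y : Blocks n) : EuclideanSpace ℝ (Fin N) :=
  P.b - ∑ j ∈ Finset.Iio i, P.mulA j (z j) - ∑ j ∈ Finset.Ioi i, P.mulA j (y j)

end Problem

/-- The subvector obtained by dropping the first block. -/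
def plus {m : ℕ} {n : Fin (m + 1) → ℕ} (x : Blocks n) : (Σ i : Fin m, Fin (n i.succ)) → ℝ :=
  fun p => x p.1.succ p.2

/-- Parameters of the algorithm that enter the accelerated scheme. -/
structure Params where
  ρ : ℝ
  σ : ℝ
  α : ℝ
  θ₁ : ℝ
  θ₂ : ℝ
  θ₃ : ℝ
  ρ_pos : 0 < ρ
  σ_mem : σ ∈ Set.Ioo (0 : ℝ) 1
  α_mem : α ∈ Set.Ioo (0 : ℝ) 1
  θ₁_pos : 0 < θ₁
  θ₂_pos : 0 < θ₂
  θ₃_pos : 0 < θ₃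

/-- Admissible tolerance functions: finite on finite arguments, zero at `0`, positive
elsewhere and continuous at `0`. The value at `∞`, used only for the initial error `e⁰ = ∞`,
is an arbitrary element of `(0, ∞]`. -/
structure IsTolerance (ψ : ℝ≥0∞ → ℝ≥0∞) : Prop where
  zero : ψ 0 = 0
  pos : ∀ s, 0 < s → 0 < ψ s
  finite : ∀ s, s ≠ ⊤ → ψ s ≠ ⊤
  cont : ContinuousAt ψ 0

/-- The quantities of one inner loop: parameter sequences `δ`, `α`, iterates `u`, `a`, `abar`,
and the terminating index. Index `0` of `δ`, `α`, `abar` and the iterates with index beyond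
`last` carry no meaning. -/
structure InnerLoop (E : Type*) where
  δ : ℕ → ℝ
  α : ℕ → ℝ
  u : ℕ → E
  a : ℕ → E
  abar : ℕ → E
  last : ℕ

/-- `γ^l = (1/δ^1) ∏_{j=2}^l (1 - α^j)⁻¹`. -/
def InnerLoop.γ {E : Type*} (D : InnerLoop E) (l : ℕ) : ℝ :=
  (1 / D.δ 1) * ∏ j ∈ Finset.Icc 2 l, (1 - D.α j)⁻¹

section

variable {m N : ℕ} {n : Fin (m + 1) → ℕ}

/-- The smooth part of the objective of the inner subproblem,
`⟨∇f_i(abar), u⟩ + δ/2 ‖u - uprev‖² + ρ/2 ‖A_i u - c + lam/ρ‖²`. -/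
def innerQ (P : Problem m N n) (ρ : ℝ) (i : Fin (m + 1))
    (c lam : EuclideanSpace ℝ (Fin N)) (δ : ℝ)
    (abar uprev u : EuclideanSpace ℝ (Fin (n i))) : ℝ :=
  inner ℝ (gradient (P.f i) abar) u + δ / 2 * ‖u - uprev‖ ^ 2
    + ρ / 2 * ‖P.mulA i u - c + ρ⁻¹ • lam‖ ^ 2

/-- `D` is an execution of the accelerated inner loop for block `i` with starting point `x₀`,
right-hand side `c`, multiplier `lam`, lower bound `Γprev` for the final `γ` and
tolerance `tol`. The loop stops at the first index at which the stopping test holds. -/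
structure IsInnerLoop (P : Problem m N n) (par : Params) (i : Fin (m + 1))
    (x₀ : EuclideanSpace ℝ (Fin (n i))) (c lam : EuclideanSpace ℝ (Fin N))
    (Γprev : ℝ) (tol : ℝ≥0∞) (D : InnerLoop (EuclideanSpace ℝ (Fin (n i)))) : Prop where
  u_zero : D.u 0 = x₀
  a_zero : D.a 0 = x₀
  δ_pos : ∀ l, 1 ≤ l → 0 < D.δ l
  α_one : D.α 1 = 1
  α_mem : ∀ l, 2 ≤ l → D.α l ∈ Set.Ioo (0 : ℝ) 1
  abar_eq : ∀ l, 1 ≤ l → l ≤ D.last →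
    D.abar l = (1 - D.α l) • D.a (l - 1) + D.α l • D.u (l - 1)
  u_min : ∀ l, 1 ≤ l → l ≤ D.last → ∀ v : EuclideanSpace ℝ (Fin (n i)),
    (innerQ P par.ρ i c lam (D.δ l) (D.abar l) (D.u (l - 1)) (D.u l) : EReal)
        + P.h i (D.u l)
      ≤ (innerQ P par.ρ i c lam (D.δ l) (D.abar l) (D.u (l - 1)) v : EReal) + P.h i v
  a_eq : ∀ l, 1 ≤ l → l ≤ D.last →
    D.a l = (1 - D.α l) • D.a (l - 1) + D.α l • D.u l
  line_search : ∀ l, 1 ≤ l → l ≤ D.last →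
    P.f i (D.a l) ≤ P.f i (D.abar l)
      + inner ℝ (gradient (P.f i) (D.abar l)) (D.a l - D.abar l)
      + (1 - par.σ) * D.δ l / (2 * D.α l) * ‖D.a l - D.abar l‖ ^ 2
  last_least : IsLeast {l : ℕ | 1 ≤ l ∧ Γprev ≤ D.γ l ∧
    ENNReal.ofReal ‖D.a l - D.a (l - 1)‖ ≤ tol} D.last

/-- An infinite run of accelerated BOSVS. Iterations are numbered `k = 1, 2, …`; the only
meaningful entries with index `0` are `Γ 0 = 0` and `e 0 = ∞`. -/
structure AcceleratedRun (P : Problem m N n) (par : Params) (ψ : ℝ≥0∞ → ℝ≥0∞) where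
  x : ℕ → Blocks n
  y : ℕ → Blocks n
  z : ℕ → Blocks n
  lam : ℕ → EuclideanSpace ℝ (Fin N)
  Γ : ℕ → Fin (m + 1) → ℝ
  r : ℕ → Fin (m + 1) → ℝ
  e : ℕ → ℝ≥0∞
  loop : ℕ → (i : Fin (m + 1)) → InnerLoop (EuclideanSpace ℝ (Fin (n i)))
  y_one : y 1 = x 1
  Γ_zero : ∀ i, Γ 0 i = 0
  e_zero : e 0 = ⊤
  step1_loop : ∀ k, 1 ≤ k → ∀ i,
    IsInnerLoop P par i (x k i) (P.blockRhs i (z k) (y k)) (lam k)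
      (Γ (k - 1) i) (ψ (e (k - 1))) (loop k i)
  step1_x : ∀ k, 1 ≤ k → ∀ i, x (k + 1) i = (loop k i).u (loop k i).last
  step1_z : ∀ k, 1 ≤ k → ∀ i, z k i = (loop k i).a (loop k i).last
  step1_Γ : ∀ k, 1 ≤ k → ∀ i, Γ k i = (loop k i).γ (loop k i).last
  step1_r : ∀ k, 1 ≤ k → ∀ i, r k i = (1 / Γ k i) *
    ∑ j ∈ Finset.Icc 1 (loop k i).last, ‖(loop k i).u j - (loop k i).u (j - 1)‖ ^ 2
  step2_e : ∀ k, 1 ≤ k → e k = ENNReal.ofReal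
    (par.θ₁ * ‖WithLp.toLp 2 (plus (z k) - plus (y k))‖
      + par.θ₂ * ‖P.residual (z k)‖ + par.θ₃ * Real.sqrt (∑ i, r k i))
  step3_y_first : ∀ k, 1 ≤ k → y (k + 1) 0 = z k 0
  step3_y_plus : ∀ k, 1 ≤ k → plus (y (k + 1)) =
    plus (y k) + par.α • ((P.Mᵀ)⁻¹ *ᵥ (P.H *ᵥ (plus (z k) - plus (y k))))
  step3_lam : ∀ k, 1 ≤ k → lam (k + 1) = lam k + (par.α * par.ρ) • P.residual (z k)

end

end BOSVS

end

/-! The proof is a Fejér monotonicity argument. For a pair (x*, λ*) in W*, the `energy` adds ρ⁻¹‖λ^k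
− λ*‖², the error of y₊^k weighted by ρ M H⁻¹ Mᵀ, and α ∑ (Γ_i^k)⁻¹ ‖x_i* − x_i^k‖². It is
nonincreasing, and its decrement controls ‖Az^k − b‖², the H-form of z₊^k − y₊^k and ∑ r_i^k.

Two computations give the descent. Within an inner loop, the normalization δαγ = 1 makes the
accelerated gradient estimates telescope (`gap_bound`). Across blocks, the Gauss–Seidel right-hand
sides sum to a form in M (`sum_inner_blockRhs`); the symmetric part of M is half of A₊ᵀA₊ + H, and
the weight M H⁻¹ Mᵀ turns the correction of y₊ into exactly this form (`weight_update`). With the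
saddle-point inequality they yield `energy_descent`.

Summability of the decrements makes the residual, z − y and e^k vanish, hence also the stopping
tolerances ψ(e^{k−1}). The bound κ ≤ γα² converts the stopping test into smallness of (Γ_i^k)⁻¹
‖x_i^{k+1} − z_i^k‖². So the right-hand side of each block estimate is asymptotically at most 0, and
every cluster point of (z^k, λ^k) lies in W* (`cluster_mem`). Taking that cluster point as the
reference pair, the energy tends to 0 along a subsequence, hence along the whole sequence by
monotonicity, and this forces convergence. -/

noncomputable section

namespace BOSVS

/-! ### Convex analysis and a single accelerated proximal step. -/

section Convexity

variable {E F : Type*} [NormedAddCommGroup E] [InnerProductSpace ℝ E]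
  [NormedAddCommGroup F] [InnerProductSpace ℝ F]

/-- The effective domain of an extended-real-valued function. -/
def dom {E : Type*} (h : E → EReal) : Set E := {u | h u ≠ ⊤}

theorem ProperClosedConvex.coe_toReal {h : E → EReal} (hh : ProperClosedConvex h) {u : E}
    (hu : u ∈ dom h) : ((h u).toReal : EReal) = h u :=
  EReal.coe_toReal hu (hh.ne_bot u)

/-- A proper convex function is a real convex function on its effective domain. -/
theorem ProperClosedConvex.convexOn {h : E → EReal} (hh : ProperClosedConvex h) :
    ConvexOn ℝ (dom h) (fun u => (h u).toReal) := by
  have key : ∀ u ∈ dom h, ∀ v ∈ dom h, ∀ s t : ℝ, 0 ≤ s → 0 ≤ t → s + t = 1 →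
      h (s • u + t • v) ≤ ((s * (h u).toReal + t * (h v).toReal : ℝ) : EReal) := by
    intro u hu v hv s t hs ht hst
    have hu' : ((u, (h u).toReal) : E × ℝ) ∈ {p : E × ℝ | h p.1 ≤ (p.2 : EReal)} := by
      simp [hh.coe_toReal hu]
    have hv' : ((v, (h v).toReal) : E × ℝ) ∈ {p : E × ℝ | h p.1 ≤ (p.2 : EReal)} := by
      simp [hh.coe_toReal hv]
    simpa using hh.convex hu' hv' hs ht hst
  have mem : ∀ u ∈ dom h, ∀ v ∈ dom h, ∀ s t : ℝ, 0 ≤ s → 0 ≤ t → s + t = 1 →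
      s • u + t • v ∈ dom h := fun u hu v hv s t hs ht hst =>
    ne_top_of_le_ne_top (EReal.coe_ne_top _) (key u hu v hv s t hs ht hst)
  refine ⟨fun u hu v hv s t hs ht hst => mem u hu v hv s t hs ht hst,
    fun u hu v hv s t hs ht hst => ?_⟩
  have := key u hu v hv s t hs ht hst
  rw [← hh.coe_toReal (mem u hu v hv s t hs ht hst)] at this
  simpa using EReal.coe_le_coe_iff.1 this

/-- The first-order lower bound for a differentiable convex function. -/
theorem gradient_inequality [CompleteSpace E] {f : E → ℝ} (hf : ConvexOn ℝ Set.univ f)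
    {x : E} (hd : DifferentiableAt ℝ f x) (y : E) :
    f x + inner ℝ (gradient f x) (y - x) ≤ f y := by
  have hc : ConvexOn ℝ Set.univ (fun t : ℝ => f (AffineMap.lineMap x y t)) := by
    have := hf.comp_affineMap (AffineMap.lineMap x y : ℝ →ᵃ[ℝ] E)
    rwa [Set.preimage_univ] at this
  have hderiv : HasDerivAt (fun t : ℝ => f (AffineMap.lineMap x y t))
      (inner ℝ (gradient f x) (y - x)) 0 := by
    have h1 : HasDerivAt (fun t : ℝ => (AffineMap.lineMap x y t : E)) (y - x) 0 :=
      AffineMap.hasDerivAt_lineMap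
    have h2 : HasFDerivAt f (InnerProductSpace.toDual ℝ E (gradient f x))
        (AffineMap.lineMap x y (0 : ℝ)) := by
      simpa using hd.hasGradientAt.hasFDerivAt
    have := h2.comp_hasDerivAt (0 : ℝ) h1
    rwa [InnerProductSpace.toDual_apply_apply] at this
  have := hc.le_slope_of_hasDerivAt (Set.mem_univ 0) (Set.mem_univ 1) zero_lt_one hderiv
  rw [slope_def_field, AffineMap.lineMap_apply_one, AffineMap.lineMap_apply_zero] at this
  linarith

/-- The optimality condition for a minimizer of the sum of a quadratic and a convex function. -/
theorem variational_inequality {S : Set E} {h : E → ℝ} (hc : ConvexOn ℝ S h)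
    (A : E →ₗ[ℝ] F) (g p : E) (c : F) (δ ρ : ℝ) {u v : E} (hu : u ∈ S) (hv : v ∈ S)
    (hmin : ∀ w ∈ S,
      inner ℝ g u + δ / 2 * ‖u - p‖ ^ 2 + ρ / 2 * ‖A u - c‖ ^ 2 + h u
        ≤ inner ℝ g w + δ / 2 * ‖w - p‖ ^ 2 + ρ / 2 * ‖A w - c‖ ^ 2 + h w) :
    h u + inner ℝ g (u - v) + δ * inner ℝ (u - p) (u - v)
      + ρ * inner ℝ (A u - c) (A (u - v)) ≤ h v := by
  -- `C` is the coefficient of t² when the quadratic part is expanded at u + t(v − u); comparing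
  -- with u, dividing by t and letting t → 0 removes it.
  set C := δ / 2 * ‖u - v‖ ^ 2 + ρ / 2 * ‖A (u - v)‖ ^ 2 with hC
  have key : ∀ t ∈ Set.Ioc (0 : ℝ) 1, h u + inner ℝ g (u - v) + δ * inner ℝ (u - p) (u - v)
      + ρ * inner ℝ (A u - c) (A (u - v)) - h v ≤ t * C := by
    rintro t ⟨ht0, ht1⟩
    have hw : (1 - t) • u + t • v ∈ S := hc.1 hu hv (by linarith) ht0.le (by ring)
    have hcw := hc.2 hu hv (sub_nonneg.2 ht1) ht0.le (sub_add_cancel 1 t)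
    have h0 := hmin _ hw
    have e1 : (1 - t) • u + t • v - p = (u - p) - t • (u - v) := by module
    have e2 : A ((1 - t) • u + t • v) - c = (A u - c) - t • A (u - v) := by
      simp only [map_add, map_smul, map_sub]; module
    have e3 : inner ℝ g ((1 - t) • u + t • v) = inner ℝ g u - t * inner ℝ g (u - v) := by
      simp only [inner_add_right, inner_smul_right, inner_sub_right]; ring
    rw [e1, e2, e3, norm_sub_sq_real (u - p), norm_sub_sq_real (A u - c), norm_smul, norm_smul,
      mul_pow, mul_pow, Real.norm_eq_abs, sq_abs, inner_smul_right, inner_smul_right] at h0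
    simp only [smul_eq_mul] at hcw
    have : t * (h u + inner ℝ g (u - v) + δ * inner ℝ (u - p) (u - v)
      + ρ * inner ℝ (A u - c) (A (u - v)) - h v) ≤ t * (t * C) := by
      rw [hC]; nlinarith
    exact le_of_mul_le_mul_left this ht0
  have hlim : Tendsto (fun t : ℝ => t * C) (𝓝[>] 0) (𝓝 0) := by
    have : Tendsto (fun t : ℝ => t * C) (𝓝 0) (𝓝 (0 * C)) := tendsto_id.mul_const C
    rw [zero_mul] at this
    exact this.mono_left nhdsWithin_le_nhds
  have := ge_of_tendsto hlim (eventually_of_mem (Ioc_mem_nhdsGT zero_lt_one) key)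
  linarith

/-- One accelerated proximal gradient step. -/
theorem accelerated_step [CompleteSpace E] {f : E → ℝ} (hf : ConvexOn ℝ Set.univ f)
    (hd : Differentiable ℝ f) {S : Set E} {h : E → ℝ} (hc : ConvexOn ℝ S h)
    (A : E →ₗ[ℝ] F) (c : F) {δ ρ α σ : ℝ} (hα0 : 0 < α) (hα1 : α ≤ 1) (hρ : 0 ≤ ρ)
    {a abar a' p u v : E} (hu : u ∈ S) (hv : v ∈ S) (ha : α = 1 ∨ a ∈ S)
    (habar : abar = (1 - α) • a + α • p) (ha' : a' = (1 - α) • a + α • u)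
    (hmin : ∀ w ∈ S,
      inner ℝ (gradient f abar) u + δ / 2 * ‖u - p‖ ^ 2 + ρ / 2 * ‖A u - c‖ ^ 2 + h u
        ≤ inner ℝ (gradient f abar) w + δ / 2 * ‖w - p‖ ^ 2 + ρ / 2 * ‖A w - c‖ ^ 2 + h w)
    (hls : f a' ≤ f abar + inner ℝ (gradient f abar) (a' - abar)
      + (1 - σ) * δ / (2 * α) * ‖a' - abar‖ ^ 2) :
    f a' + h a' - f v - h v + ρ * inner ℝ (A a' - c) (A (a' - v))
      ≤ (1 - α) * (f a + h a - f v - h v + ρ * inner ℝ (A a - c) (A (a - v)))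
        + α * δ / 2 * (‖v - p‖ ^ 2 - ‖v - u‖ ^ 2 - σ * ‖u - p‖ ^ 2) := by
  have hvi := variational_inequality hc A (gradient f abar) p c δ ρ hu hv hmin
  have hga := gradient_inequality hf (hd abar) a
  have hgv := gradient_inequality hf (hd abar) v
  have hh : h a' ≤ (1 - α) * h a + α * h u := by
    -- When α = 1 the point `a` has weight zero and need not lie in `S`. The first inner step needs
    -- this, since the initial x may lie outside the domain.
    rcases ha with rfl | ha
    · simp [ha']
    · rw [ha']
      exact hc.2 ha hu (by linarith) hα0.le (by ring)
  -- Both averages use the same `a`, so the line-search term becomes α times (1 − σ)δ/2 ‖u − p‖².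
  -- This is what the three-point identity `hthree` can absorb, leaving the σ term.
  have hdiff : a' - abar = α • (u - p) := by rw [ha', habar]; module
  have hsplit : inner ℝ (gradient f abar) (a' - abar)
      = (1 - α) * inner ℝ (gradient f abar) (a - abar)
        + α * inner ℝ (gradient f abar) (v - abar) + α * inner ℝ (gradient f abar) (u - v) := by
    rw [ha']
    simp only [inner_sub_right, inner_add_right, inner_smul_right]; ring
  have hquad : (1 - σ) * δ / (2 * α) * ‖a' - abar‖ ^ 2 = (1 - σ) * δ * α / 2 * ‖u - p‖ ^ 2 := by
    rw [hdiff, norm_smul, mul_pow, Real.norm_eq_abs, sq_abs]; field_simp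
  have hthree : 2 * inner ℝ (u - p) (u - v) = ‖u - p‖ ^ 2 + ‖v - u‖ ^ 2 - ‖v - p‖ ^ 2 := by
    have : v - p = (u - p) - (u - v) := by abel
    rw [this, norm_sub_sq_real (u - p), norm_sub_rev v u]; ring
  -- The map w ↦ ⟨Aw − c, A(w − v)⟩ is a convex quadratic; the slack is α(1 − α)‖A(u − a)‖².
  have hconv : inner ℝ (A a' - c) (A (a' - v))
      ≤ (1 - α) * inner ℝ (A a - c) (A (a - v)) + α * inner ℝ (A u - c) (A (u - v)) := by
    have e1 : A a' - c = (A a - c) + α • A (u - a) := by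
      rw [ha']; simp only [map_add, map_smul, map_sub]; module
    have e2 : A (a' - v) = A (a - v) + α • A (u - a) := by
      rw [ha']; simp only [map_add, map_smul, map_sub]; module
    have e3 : A u - c = (A a - c) + A (u - a) := by simp only [map_sub]; abel
    have e4 : A (u - v) = A (a - v) + A (u - a) := by simp only [map_sub]; abel
    rw [e1, e2, e3, e4]
    simp only [inner_add_left, inner_add_right, inner_smul_left, inner_smul_right,
      real_inner_self_eq_norm_sq, conj_trivial]
    nlinarith [mul_nonneg (mul_nonneg hα0.le (sub_nonneg.2 hα1)) (sq_nonneg ‖A (u - a)‖)]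
  have m1 := mul_le_mul_of_nonneg_left hvi hα0.le
  have m2 := mul_le_mul_of_nonneg_left hga (sub_nonneg.2 hα1)
  have m3 := mul_le_mul_of_nonneg_left hgv hα0.le
  have m4 := mul_le_mul_of_nonneg_left hconv hρ
  rw [hsplit, hquad] at hls
  have h5 : α * (δ * inner ℝ (u - p) (u - v))
      = α * δ / 2 * (‖u - p‖ ^ 2 + ‖v - u‖ ^ 2 - ‖v - p‖ ^ 2) := by rw [← hthree]; ring
  nlinarith

/-- Real upper bounds pass to the limit under a lower semicontinuous function. -/
theorem le_of_tendsto_of_lowerSemicontinuous {X : Type*} [TopologicalSpace X] {h : X → EReal}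
    (hh : LowerSemicontinuous h) {x : ℕ → X} {c : ℕ → ℝ} {x₀ : X} {c₀ : ℝ}
    (hx : Tendsto x atTop (𝓝 x₀)) (hc : Tendsto c atTop (𝓝 c₀))
    (hle : ∀ᶠ j in atTop, h (x j) ≤ (c j : EReal)) : h x₀ ≤ (c₀ : EReal) := by
  by_contra hlt
  obtain ⟨d, hd1, hd2⟩ := EReal.lt_iff_exists_real_btwn.1 (not_le.1 hlt)
  have h1 := hx.eventually (hh x₀ _ hd2)
  have h2 := hc.eventually (gt_mem_nhds (EReal.coe_lt_coe_iff.1 hd1))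
  obtain ⟨j, ⟨hj1, hj2⟩, hj3⟩ := ((h1.and h2).and hle).exists
  exact absurd ((hj1.trans_le hj3).trans (EReal.coe_lt_coe_iff.2 hj2)) (lt_irrefl _)

end Convexity

/-! ### Estimates for one inner loop. -/

section InnerLoops

theorem InnerLoop.γ_one {E : Type*} (D : InnerLoop E) : D.γ 1 = 1 / D.δ 1 := by
  simp [InnerLoop.γ]

theorem InnerLoop.γ_succ {E : Type*} (D : InnerLoop E) {l : ℕ} (hl : 1 ≤ l) :
    D.γ (l + 1) = D.γ l * (1 - D.α (l + 1))⁻¹ := by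
  rw [InnerLoop.γ, InnerLoop.γ, Finset.prod_Icc_succ_top (by omega), mul_assoc]

variable {m N : ℕ} {n : Fin (m + 1) → ℕ} {P : Problem m N n} {par : Params} {i : Fin (m + 1)}
  {x₀ : EuclideanSpace ℝ (Fin (n i))} {c lam : EuclideanSpace ℝ (Fin N)} {Γprev : ℝ}
  {tol : ℝ≥0∞} {D : InnerLoop (EuclideanSpace ℝ (Fin (n i)))}

namespace IsInnerLoop

theorem γ_succ_mul (hD : IsInnerLoop P par i x₀ c lam Γprev tol D) {l : ℕ} (hl : 1 ≤ l) :
    D.γ (l + 1) * (1 - D.α (l + 1)) = D.γ l := by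
  have h1 := (hD.α_mem (l + 1) (by omega)).2
  rw [D.γ_succ hl, mul_assoc, inv_mul_cancel₀ (by linarith), mul_one]

theorem γ_pos (hD : IsInnerLoop P par i x₀ c lam Γprev tol D) {l : ℕ} (hl : 1 ≤ l) :
    0 < D.γ l := by
  induction l, hl using Nat.le_induction with
  | base => rw [D.γ_one]; exact one_div_pos.2 (hD.δ_pos 1 le_rfl)
  | succ l hl ih =>
    have h1 := (hD.α_mem (l + 1) (by omega)).2
    rw [D.γ_succ hl]
    exact mul_pos ih (inv_pos.2 (by linarith))

theorem α_pos (hD : IsInnerLoop P par i x₀ c lam Γprev tol D) {l : ℕ} (hl : 1 ≤ l) :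
    0 < D.α l := by
  rcases hl.eq_or_lt with rfl | hl
  · rw [hD.α_one]; exact one_pos
  · exact (hD.α_mem l hl).1

theorem α_le_one (hD : IsInnerLoop P par i x₀ c lam Γprev tol D) {l : ℕ} (hl : 1 ≤ l) :
    D.α l ≤ 1 := by
  rcases hl.eq_or_lt with rfl | hl
  · rw [hD.α_one]
  · exact (hD.α_mem l hl).2.le

theorem one_le_last (hD : IsInnerLoop P par i x₀ c lam Γprev tol D) : 1 ≤ D.last :=
  hD.last_least.1.1

theorem u_mem_dom (hD : IsInnerLoop P par i x₀ c lam Γprev tol D) (hP : P.Standing) {l : ℕ}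
    (hl : 1 ≤ l) (hlast : l ≤ D.last) : D.u l ∈ dom (P.h i) := by
  obtain ⟨v, hv⟩ := (hP.h_pcc i).proper
  intro htop
  have := hD.u_min l hl hlast v
  rw [htop, EReal.coe_add_top, ← (hP.h_pcc i).coe_toReal (u := v) hv, ← EReal.coe_add] at this
  exact EReal.coe_ne_top _ (top_le_iff.1 this)

/-- The gap function that one inner loop reduces. -/
def gap (P : Problem m N n) (ρ : ℝ) (i : Fin (m + 1)) (c lam : EuclideanSpace ℝ (Fin N))
    (v a : EuclideanSpace ℝ (Fin (n i))) : ℝ :=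
  P.f i a + (P.h i a).toReal - P.f i v - (P.h i v).toReal
    + ρ * inner ℝ (P.mulA i a - c + ρ⁻¹ • lam) (P.mulA i (a - v))

theorem gap_step (hD : IsInnerLoop P par i x₀ c lam Γprev tol D) (hP : P.Standing) {l : ℕ}
    (hlast : l + 1 ≤ D.last) {v : EuclideanSpace ℝ (Fin (n i))} (hv : v ∈ dom (P.h i))
    (ha : D.α (l + 1) = 1 ∨ D.a l ∈ dom (P.h i)) :
    gap P par.ρ i c lam v (D.a (l + 1)) ≤ (1 - D.α (l + 1)) * gap P par.ρ i c lam v (D.a l)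
      + D.α (l + 1) * D.δ (l + 1) / 2 * (‖v - D.u l‖ ^ 2 - ‖v - D.u (l + 1)‖ ^ 2
        - par.σ * ‖D.u (l + 1) - D.u l‖ ^ 2) := by
  have h1 : 1 ≤ l + 1 := by omega
  have hu := hD.u_mem_dom hP h1 hlast
  have e : ∀ w : EuclideanSpace ℝ (Fin (n i)), P.mulA i w - c + par.ρ⁻¹ • lam
      = Matrix.toEuclideanLin (P.A i) w - (c - par.ρ⁻¹ • lam) := fun w => by
    rw [Problem.mulA]; abel
  have := accelerated_step (hP.f_convex i) (hP.f_diff i) (hP.h_pcc i).convexOn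
    (Matrix.toEuclideanLin (P.A i)) (c - par.ρ⁻¹ • lam) (hD.α_pos h1) (hD.α_le_one h1)
    par.ρ_pos.le hu hv ha (hD.abar_eq (l + 1) h1 hlast) (hD.a_eq (l + 1) h1 hlast)
    (δ := D.δ (l + 1)) (σ := par.σ) ?_ (hD.line_search (l + 1) h1 hlast)
  · simp only [gap, e]
    exact this
  · intro w hw
    have := hD.u_min (l + 1) h1 hlast w
    rw [← (hP.h_pcc i).coe_toReal hw, ← (hP.h_pcc i).coe_toReal hu, ← EReal.coe_add,
      ← EReal.coe_add, EReal.coe_le_coe_iff] at this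
    simpa only [innerQ, e] using this

/-- Multiply `gap_step` by γ^{l+1}: since γ^{l+1}(1 − α^{l+1}) = γ^l and δαγ = 1, the gaps telescope
and the distance terms acquire the constant weight 1/2. Membership of a^l in the domain is carried
along because convexity of h is used at a^l in the next step. -/
theorem gap_bound (hD : IsInnerLoop P par i x₀ c lam Γprev tol D) (hP : P.Standing)
    (hξ : ∀ l, 1 ≤ l → D.δ l * D.α l * D.γ l = 1) {l : ℕ} (hl : 1 ≤ l) (hlast : l ≤ D.last)
    {v : EuclideanSpace ℝ (Fin (n i))} (hv : v ∈ dom (P.h i)) :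
    D.a l ∈ dom (P.h i) ∧ D.γ l * gap P par.ρ i c lam v (D.a l) ≤
      1 / 2 * (‖v - x₀‖ ^ 2 - ‖v - D.u l‖ ^ 2
        - par.σ * ∑ j ∈ Finset.Icc 1 l, ‖D.u j - D.u (j - 1)‖ ^ 2) := by
  induction l, hl using Nat.le_induction with
  | base =>
    -- Since α^1 = 1, the gap at x₀ has coefficient zero, so the value 0 that `toReal` gives an
    -- infinite h(x₀) is harmless.
    have hstep := hD.gap_step hP (l := 0) hlast hv (Or.inl hD.α_one)
    have ha := hD.a_eq 1 le_rfl hlast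
    simp only [hD.α_one, sub_self, zero_smul, one_smul, zero_add] at ha
    refine ⟨ha ▸ hD.u_mem_dom hP le_rfl hlast, ?_⟩
    have hγ := mul_le_mul_of_nonneg_left hstep (hD.γ_pos le_rfl).le
    have hx := hξ 1 le_rfl
    simp only [zero_add, hD.α_one, mul_one, one_mul, sub_self, zero_mul, hD.u_zero] at hγ hx
    simp only [Finset.Icc_self, Finset.sum_singleton, Nat.sub_self, hD.u_zero]
    calc _ ≤ _ := hγ
      _ = (D.δ 1 * D.γ 1) / 2 * (‖v - x₀‖ ^ 2 - ‖v - D.u 1‖ ^ 2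
        - par.σ * ‖D.u 1 - x₀‖ ^ 2) := by ring
      _ = _ := by rw [hx]
  | succ l hl ih =>
    obtain ⟨hal, ihl⟩ := ih (by omega)
    have hstep := hD.gap_step hP (l := l) hlast hv (Or.inr hal)
    have h1 : 1 ≤ l + 1 := by omega
    have ha := hD.a_eq (l + 1) h1 hlast
    rw [Nat.add_sub_cancel] at ha
    refine ⟨?_, ?_⟩
    · rw [ha]
      exact (hP.h_pcc i).convexOn.1 hal (hD.u_mem_dom hP h1 hlast)
        (sub_nonneg.2 (hD.α_le_one h1)) (hD.α_pos h1).le (by ring)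
    · have hγ := mul_le_mul_of_nonneg_left hstep (hD.γ_pos h1).le
      rw [Finset.sum_Icc_succ_top h1, Nat.add_sub_cancel]
      calc _ ≤ _ := hγ
        _ = (D.γ (l + 1) * (1 - D.α (l + 1))) * gap P par.ρ i c lam v (D.a l)
            + (D.δ (l + 1) * D.α (l + 1) * D.γ (l + 1)) / 2 * (‖v - D.u l‖ ^ 2
              - ‖v - D.u (l + 1)‖ ^ 2 - par.σ * ‖D.u (l + 1) - D.u l‖ ^ 2) := by ring
        _ ≤ _ := by rw [hD.γ_succ_mul hl, hξ _ h1]; linarith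

theorem a_last_mem_dom (hD : IsInnerLoop P par i x₀ c lam Γprev tol D) (hP : P.Standing)
    (hξ : ∀ l, 1 ≤ l → D.δ l * D.α l * D.γ l = 1) : D.a D.last ∈ dom (P.h i) := by
  obtain ⟨v, hv⟩ := (hP.h_pcc i).proper
  exact (hD.gap_bound hP hξ hD.one_le_last le_rfl hv).1

/-- The estimate satisfied by the output of one inner loop. -/
theorem gap_last_le (hD : IsInnerLoop P par i x₀ c lam Γprev tol D) (hP : P.Standing)
    (hξ : ∀ l, 1 ≤ l → D.δ l * D.α l * D.γ l = 1) {v : EuclideanSpace ℝ (Fin (n i))}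
    (hv : v ∈ dom (P.h i)) :
    P.f i (D.a D.last) + (P.h i (D.a D.last)).toReal - P.f i v - (P.h i v).toReal
        + par.ρ * inner ℝ (P.mulA i (D.a D.last) - c) (P.mulA i (D.a D.last - v))
        + inner ℝ lam (P.mulA i (D.a D.last - v)) ≤
      1 / 2 * ((D.γ D.last)⁻¹ * ‖v - x₀‖ ^ 2 - (D.γ D.last)⁻¹ * ‖v - D.u D.last‖ ^ 2
        - par.σ * ((1 / D.γ D.last)
          * ∑ j ∈ Finset.Icc 1 D.last, ‖D.u j - D.u (j - 1)‖ ^ 2)) := by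
  have hb := (hD.gap_bound hP hξ hD.one_le_last le_rfl hv).2
  have hγ := hD.γ_pos hD.one_le_last
  rw [← le_div_iff₀' hγ, gap, inner_add_left, inner_smul_left] at hb
  have hρ := par.ρ_pos.ne'
  calc _ = _ := by
        rw [mul_add, ← mul_assoc par.ρ]; simp [hρ]; ring
    _ ≤ _ := hb
    _ = _ := by field_simp

/-- The distance between the two outputs of an inner loop is controlled by its last step. -/
theorem dist_u_a_last_le (hD : IsInnerLoop P par i x₀ c lam Γprev tol D) {κ : ℝ} (hκ : 0 < κ)
    (hκγ : ∀ l, 1 ≤ l → κ ≤ D.γ l * D.α l ^ 2) :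
    (D.γ D.last)⁻¹ * ‖D.u D.last - D.a D.last‖ ^ 2
      ≤ ‖D.a D.last - D.a (D.last - 1)‖ ^ 2 / κ := by
  have h1 := hD.one_le_last
  have hγ := hD.γ_pos h1
  have hα0 := hD.α_pos h1
  have hα1 := hD.α_le_one h1
  -- Both distances are multiples of `d`: u^l − a^l has norm (1 − α)d, and a^l − a^{l−1} has norm
  -- αd. The bound κ ≤ γα² then compares γ⁻¹d² with (αd)².
  set d := ‖D.u D.last - D.a (D.last - 1)‖ with hd
  have e1 : ‖D.u D.last - D.a D.last‖ = (1 - D.α D.last) * d := by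
    rw [hd, ← abs_of_nonneg (sub_nonneg.2 hα1), ← Real.norm_eq_abs, ← norm_smul,
      hD.a_eq _ h1 le_rfl]
    congr 1; module
  have e2 : ‖D.a D.last - D.a (D.last - 1)‖ = D.α D.last * d := by
    rw [hd, ← Real.norm_of_nonneg hα0.le, ← norm_smul]
    nth_rewrite 1 [hD.a_eq _ h1 le_rfl]
    congr 1; module
  have e3 : ‖D.u D.last - D.a D.last‖ ^ 2 ≤ d ^ 2 := by
    rw [e1]
    exact pow_le_pow_left₀ (by positivity) (mul_le_of_le_one_left (norm_nonneg _) (by linarith)) 2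
  rw [e2, inv_mul_le_iff₀ hγ, mul_pow, mul_div_assoc', le_div_iff₀ hκ]
  calc _ ≤ d ^ 2 * (D.γ D.last * D.α D.last ^ 2) :=
        mul_le_mul e3 (hκγ _ h1) hκ.le (by positivity)
    _ = _ := by ring

end IsInnerLoop

end InnerLoops

/-! ### Quadratic forms and the matrices M, H and M H⁻¹ Mᵀ. -/

/-- A positive definite quadratic form dominates a multiple of the squared coordinates. -/
theorem exists_sq_le_of_posDef {ι : Type*} [Fintype ι] {S : Matrix ι ι ℝ} (hS : S.PosDef) :
    ∃ C : ℝ, 0 < C ∧ ∀ (v : ι → ℝ) (p : ι), v p ^ 2 ≤ C * (v ⬝ᵥ S *ᵥ v) := by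
  have hcont : Continuous fun v : ι → ℝ => v ⬝ᵥ S *ᵥ v := by fun_prop
  have hpos : ∀ v : ι → ℝ, v ≠ 0 → 0 < v ⬝ᵥ S *ᵥ v := fun v hv => by
    simpa using hS.dotProduct_mulVec_pos hv
  -- The sphere is empty when there are no coordinates, as with a single block. Otherwise
  -- compactness supplies the least value of the form on the unit sphere of the sup norm.
  rcases (Metric.sphere (0 : ι → ℝ) 1).eq_empty_or_nonempty with hem | hne
  · refine ⟨1, one_pos, fun v p => ?_⟩
    have hv : v = 0 := by
      by_contra hv
      have : ‖v‖⁻¹ • v ∈ Metric.sphere (0 : ι → ℝ) 1 := by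
        simp [norm_smul, norm_ne_zero_iff.2 hv]
      simp [hem] at this
    simp [hv]
  · obtain ⟨w, hw, hmin⟩ := (isCompact_sphere (0 : ι → ℝ) 1).exists_isMinOn hne
      hcont.continuousOn
    have hw0 : w ≠ 0 := by
      rintro rfl
      simp at hw
    have hμ := hpos w hw0
    refine ⟨(w ⬝ᵥ S *ᵥ w)⁻¹, inv_pos.2 hμ, fun v p => ?_⟩
    rcases eq_or_ne v 0 with rfl | hv
    · simp
    have hn : ‖v‖ ≠ 0 := norm_ne_zero_iff.2 hv
    have hmem : ‖v‖⁻¹ • v ∈ Metric.sphere (0 : ι → ℝ) 1 := by simp [norm_smul, hn]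
    have h1 : w ⬝ᵥ S *ᵥ w ≤ (‖v‖⁻¹ • v) ⬝ᵥ S *ᵥ (‖v‖⁻¹ • v) := hmin hmem
    rw [Matrix.mulVec_smul, dotProduct_smul, smul_dotProduct, smul_eq_mul, smul_eq_mul] at h1
    have h2 : ‖v‖ ^ 2 * (w ⬝ᵥ S *ᵥ w) ≤ v ⬝ᵥ S *ᵥ v := by
      calc _ ≤ ‖v‖ ^ 2 * (‖v‖⁻¹ * (‖v‖⁻¹ * (v ⬝ᵥ S *ᵥ v))) := by gcongr
        _ = _ := by field_simp
    have h3 : v p ^ 2 ≤ ‖v‖ ^ 2 := by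
      rw [← sq_abs]
      exact pow_le_pow_left₀ (abs_nonneg _) (norm_le_pi_norm v p) 2
    rw [← div_eq_inv_mul, le_div_iff₀ hμ]
    exact (mul_le_mul_of_nonneg_right h3 hμ.le).trans h2

namespace Problem

variable {m N : ℕ} {n : Fin (m + 1) → ℕ} (P : Problem m N n)

theorem mulA_sub (i : Fin (m + 1)) (u v : EuclideanSpace ℝ (Fin (n i))) :
    P.mulA i (u - v) = P.mulA i u - P.mulA i v := map_sub _ _ _

theorem continuous_mulA (i : Fin (m + 1)) : Continuous (P.mulA i) :=
  LinearMap.continuous_of_finiteDimensional (Matrix.toEuclideanLin (P.A i))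

variable {P} in
theorem Standing.mulA_bound (hP : P.Standing) (i : Fin (m + 1)) :
    ∃ K : ℝ, 0 < K ∧ ∀ v, ‖v‖ ≤ K * ‖P.mulA i v‖ := by
  have hinj : Function.Injective (Matrix.toEuclideanLin (P.A i)) := by
    intro u v huv
    have := Matrix.mulVec_injective_iff.2 (hP.A_indep i)
    apply WithLp.ofLp_injective 2
    apply this
    simpa [Matrix.toLpLin_apply] using huv
  obtain ⟨K, hK0, hK⟩ := (LinearMap.injective_iff_antilipschitz _).1 hinj
  exact ⟨K, hK0, fun v => ZeroHomClass.bound_of_antilipschitz _ hK v⟩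

theorem inner_mulA (i j : Fin (m + 1)) (u : EuclideanSpace ℝ (Fin (n i)))
    (v : EuclideanSpace ℝ (Fin (n j))) :
    inner ℝ (P.mulA i u) (P.mulA j v)
      = ∑ s, ∑ t, u s * (((P.A i)ᵀ * P.A j) s t * v t) := by
  have h : ∑ s, ∑ t, u s * (((P.A i)ᵀ * P.A j) s t * v t)
      = u.ofLp ⬝ᵥ ((P.A i)ᵀ * P.A j) *ᵥ v.ofLp := by
    simp only [dotProduct, Matrix.mulVec, Finset.mul_sum]
  rw [h, ← Matrix.mulVec_mulVec, Matrix.dotProduct_mulVec, Matrix.vecMul_transpose,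
    EuclideanSpace.inner_eq_star_dotProduct, star_trivial, dotProduct_comm]
  rfl

/-- The bilinear form of `M` in terms of blocks. -/
theorem plus_dotProduct_M (u v : Blocks n) :
    plus u ⬝ᵥ P.M *ᵥ plus v = ∑ i : Fin m, ∑ j : Fin m,
      if j ≤ i then inner ℝ (P.mulA i.succ (u i.succ)) (P.mulA j.succ (v j.succ)) else 0 := by
  simp only [dotProduct, Matrix.mulVec, Fintype.sum_sigma, plus, M, Matrix.of_apply,
    Finset.mul_sum]
  refine Finset.sum_congr rfl fun i _ => ?_
  rw [Finset.sum_comm]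
  refine Finset.sum_congr rfl fun j _ => ?_
  split_ifs with h
  · rw [inner_mulA]
  · simp

theorem plus_dotProduct_H (u v : Blocks n) :
    plus u ⬝ᵥ P.H *ᵥ plus v = ∑ i : Fin m,
      inner ℝ (P.mulA i.succ (u i.succ)) (P.mulA i.succ (v i.succ)) := by
  simp only [dotProduct, Matrix.mulVec, Fintype.sum_sigma, plus, H,
    Finset.mul_sum, Matrix.blockDiagonal'_apply]
  refine Finset.sum_congr rfl fun i _ => ?_
  rw [inner_mulA]
  refine Finset.sum_congr rfl fun s _ => ?_
  rw [Finset.sum_eq_single i]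
  · simp
  · intro j _ hj
    simp [hj.symm]
  · simp

theorem plus_dotProduct_H_self (w : Blocks n) :
    plus w ⬝ᵥ P.H *ᵥ plus w = ∑ i : Fin m, ‖P.mulA i.succ (w i.succ)‖ ^ 2 := by
  simp [plus_dotProduct_H]

/-- The symmetric part of `M` is half of `A₊ᵀ A₊ + H`. -/
theorem plus_dotProduct_M_self (w : Blocks n) :
    plus w ⬝ᵥ P.M *ᵥ plus w = 1 / 2 * (‖∑ i : Fin m, P.mulA i.succ (w i.succ)‖ ^ 2
      + plus w ⬝ᵥ P.H *ᵥ plus w) := by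
  rw [plus_dotProduct_M, plus_dotProduct_H, ← real_inner_self_eq_norm_sq]
  set d : Fin m → EuclideanSpace ℝ (Fin N) := fun i => P.mulA i.succ (w i.succ) with hd
  change ∑ i, ∑ j, (if j ≤ i then inner ℝ (d i) (d j) else 0) =
    1 / 2 * (inner ℝ (∑ i, d i) (∑ i, d i) + ∑ i, inner ℝ (d i) (d i))
  have h1 : ∑ i, ∑ j, (if j ≤ i then inner ℝ (d i) (d j) else 0)
      = ∑ i, ∑ j, (if i ≤ j then inner ℝ (d i) (d j) else 0) := by
    rw [Finset.sum_comm]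
    simp only [real_inner_comm]
  have h2 : ∑ i, ∑ j, (if j ≤ i then inner ℝ (d i) (d j) else 0)
      + ∑ i, ∑ j, (if i ≤ j then inner ℝ (d i) (d j) else 0)
      -- The two triangular sums together cover every pair (i, j) once and the diagonal a second
      -- time.
      = inner ℝ (∑ i, d i) (∑ i, d i) + ∑ i, inner ℝ (d i) (d i) := by
    rw [sum_inner, ← Finset.sum_add_distrib, ← Finset.sum_add_distrib]
    refine Finset.sum_congr rfl fun i _ => ?_
    have h3 : inner ℝ (d i) (d i) = ∑ j, if i = j then inner ℝ (d i) (d j) else 0 := by simp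
    rw [inner_sum, h3, ← Finset.sum_add_distrib, ← Finset.sum_add_distrib]
    refine Finset.sum_congr rfl fun j _ => ?_
    rcases lt_trichotomy i j with h | h | h
    · simp [h.le, h.not_ge, h.ne]
    · simp [h]
    · simp [h.le, h.not_ge, h.ne']
  linarith

theorem exists_plus_eq (v : (Σ i : Fin m, Fin (n i.succ)) → ℝ) : ∃ w : Blocks n, plus w = v := by
  refine ⟨Fin.cons 0 fun i => WithLp.toLp 2 fun s => v ⟨i, s⟩, ?_⟩
  ext ⟨i, s⟩
  simp [plus]

theorem plus_eq_zero_of_mulA {P : Problem m N n} (hP : P.Standing) {w : Blocks n}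
    (h : ∀ i : Fin m, P.mulA i.succ (w i.succ) = 0) : plus w = 0 := by
  ext ⟨i, s⟩
  obtain ⟨K, -, hK⟩ := hP.mulA_bound i.succ
  have := hK (w i.succ)
  rw [h i, norm_zero, mul_zero] at this
  simp [plus, norm_le_zero_iff.1 this]

variable {P} in
theorem Standing.H_posDef (hP : P.Standing) : P.H.PosDef := by
  refine Matrix.PosDef.of_dotProduct_mulVec_pos ?_ ?_
  · rw [Matrix.IsHermitian, H, Matrix.blockDiagonal'_conjTranspose]
    simp
  · intro v hv
    obtain ⟨w, rfl⟩ := exists_plus_eq v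
    rw [star_trivial, plus_dotProduct_H_self]
    by_contra hle
    apply hv
    apply plus_eq_zero_of_mulA hP
    intro i
    have h0 := (Finset.sum_eq_zero_iff_of_nonneg (fun i _ => sq_nonneg _)).1
      (le_antisymm (not_lt.1 hle) (Finset.sum_nonneg fun i _ => sq_nonneg _)) i
      (Finset.mem_univ i)
    simpa using h0

-- If Mv = 0, then 0 = vᵀMv = ½(‖A₊v‖² + vᵀHv), which contradicts positivity of H unless v = 0.
variable {P} in
theorem Standing.M_isUnit (hP : P.Standing) : IsUnit P.M := by
  rw [← Matrix.mulVec_injective_iff_isUnit, ← Matrix.coe_mulVecLin,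
    injective_iff_map_eq_zero]
  intro v hv
  rw [Matrix.mulVecLin_apply] at hv
  by_contra hne
  have hpos : 0 < v ⬝ᵥ P.H *ᵥ v := by simpa using hP.H_posDef.dotProduct_mulVec_pos hne
  obtain ⟨w, rfl⟩ := exists_plus_eq v
  have := P.plus_dotProduct_M_self w
  rw [hv, dotProduct_zero] at this
  nlinarith [sq_nonneg ‖∑ i : Fin m, P.mulA i.succ (w i.succ)‖]

/-- The matrix `M H⁻¹ Mᵀ` weighting the errors in `y₊`. -/
def weight : Matrix (Σ i : Fin m, Fin (n i.succ)) (Σ i : Fin m, Fin (n i.succ)) ℝ :=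
  P.M * P.H⁻¹ * P.Mᵀ

variable {P} in
theorem Standing.weight_posDef (hP : P.Standing) : P.weight.PosDef := by
  have := hP.H_posDef.inv.mul_mul_conjTranspose_same (B := P.M)
    (Matrix.vecMul_injective_iff_isUnit.2 hP.M_isUnit)
  simpa [weight] using this

variable {P} in
/-- The effect of the correction step for `y₊` on the weighted error. -/
theorem Standing.weight_update (hP : P.Standing)
    (v w : (Σ i : Fin m, Fin (n i.succ)) → ℝ) (α : ℝ) :
    (v + α • ((P.Mᵀ)⁻¹ *ᵥ (P.H *ᵥ w))) ⬝ᵥ P.weight *ᵥ (v + α • ((P.Mᵀ)⁻¹ *ᵥ (P.H *ᵥ w)))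
      = v ⬝ᵥ P.weight *ᵥ v + 2 * α * (v ⬝ᵥ P.M *ᵥ w) + α ^ 2 * (w ⬝ᵥ P.H *ᵥ w) := by
  set s := (P.Mᵀ)⁻¹ *ᵥ (P.H *ᵥ w) with hs
  have hM : IsUnit P.Mᵀ.det := by
    rw [Matrix.det_transpose, ← Matrix.isUnit_iff_isUnit_det]; exact hP.M_isUnit
  have hH : IsUnit P.H.det := (Matrix.isUnit_iff_isUnit_det _).1 hP.H_posDef.isUnit
  have h1 : P.Mᵀ *ᵥ s = P.H *ᵥ w := by
    rw [hs, Matrix.mulVec_mulVec, Matrix.mul_nonsing_inv _ hM, Matrix.one_mulVec]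
  -- This identity is the reason for the weight: it cancels the factor M⁻ᵀH of the correction step
  -- and leaves M itself in the cross term.
  have h2 : P.weight *ᵥ s = P.M *ᵥ w := by
    rw [weight, ← Matrix.mulVec_mulVec, h1, ← Matrix.mulVec_mulVec, Matrix.mulVec_mulVec _ P.H⁻¹,
      Matrix.nonsing_inv_mul _ hH, Matrix.one_mulVec]
  have hsymm : P.weightᵀ = P.weight := by
    simpa using hP.weight_posDef.isHermitian.eq
  have h3 : s ⬝ᵥ P.weight *ᵥ v = v ⬝ᵥ P.M *ᵥ w := by
    rw [← h2, dotProduct_comm, Matrix.dotProduct_mulVec v, ← Matrix.mulVec_transpose, hsymm]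
  have h4 : s ⬝ᵥ P.M *ᵥ w = w ⬝ᵥ P.H *ᵥ w := by
    rw [Matrix.dotProduct_mulVec, ← Matrix.mulVec_transpose, h1, dotProduct_comm]
  rw [Matrix.mulVec_add, Matrix.mulVec_smul, h2, add_dotProduct, dotProduct_add, dotProduct_add,
    smul_dotProduct, smul_dotProduct, dotProduct_smul, dotProduct_smul, h3, h4]
  simp only [smul_eq_mul]
  ring

theorem sum_mulA_eq (z : Blocks n) (i : Fin (m + 1)) :
    ∑ j, P.mulA j (z j) = P.mulA i (z i) + ∑ j ∈ Finset.Iio i, P.mulA j (z j)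
      + ∑ j ∈ Finset.Ioi i, P.mulA j (z j) := by
  have e1 : Finset.Iio i = Finset.univ.filter (· < i) := by ext; simp
  have e2 : Finset.Ioi i = Finset.univ.filter (i < ·) := by ext; simp
  have e3 : P.mulA i (z i) = ∑ j, if j = i then P.mulA j (z j) else 0 := by simp
  rw [e3, e1, e2, Finset.sum_filter, Finset.sum_filter, ← Finset.sum_add_distrib,
    ← Finset.sum_add_distrib]
  refine Finset.sum_congr rfl fun j _ => ?_
  rcases lt_trichotomy i j with h | h | h
  · simp [h, h.not_gt, h.ne']
  · simp [h]
  · simp [h, h.not_gt, h.ne]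

/-- Summing the multiplier terms of the block subproblems. -/
theorem sum_inner_blockRhs {xs : Blocks n} (hxs : P.residual xs = 0) (z y : Blocks n) :
    ∑ i, inner ℝ (P.mulA i (z i) - P.blockRhs i z y) (P.mulA i (z i - xs i))
      = ‖P.residual z‖ ^ 2
        - inner ℝ (∑ j : Fin m, P.mulA j.succ (z j.succ - y j.succ)) (P.residual z)
        + (plus (z - xs)) ⬝ᵥ P.M *ᵥ (plus (z - y)) := by
  set a : Fin (m + 1) → EuclideanSpace ℝ (Fin N) := fun i => P.mulA i (z i - xs i) with ha
  set d : Fin (m + 1) → EuclideanSpace ℝ (Fin N) := fun i => P.mulA i (z i - y i) with hd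
  have hr : P.residual z = ∑ i, a i := by
    have : ∑ i, a i = P.residual z - P.residual xs := by
      simp [ha, mulA_sub, residual]
    rw [this, hxs, sub_zero]
  -- Block i sees the new z_j for j < i and the old y_j for j > i, so its residual misses the full
  -- one by the later increments only.
  have hrhs : ∀ i, P.mulA i (z i) - P.blockRhs i z y
      = P.residual z - ∑ j, if i < j then d j else 0 := by
    intro i
    have h2 : (∑ j, if i < j then d j else 0) = ∑ j ∈ Finset.Ioi i, P.mulA j (z j)
        - ∑ j ∈ Finset.Ioi i, P.mulA j (y j) := by
      have e2 : Finset.Ioi i = Finset.univ.filter (i < ·) := by ext; simp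
      rw [← Finset.sum_filter, ← e2, ← Finset.sum_sub_distrib]
      exact Finset.sum_congr rfl fun j _ => P.mulA_sub _ _ _
    rw [h2, residual, P.sum_mulA_eq z i, blockRhs]
    abel
  simp only [hrhs, inner_sub_left, Finset.sum_sub_distrib]
  have h1 : ∑ i, inner ℝ (P.residual z) (P.mulA i (z i - xs i)) = ‖P.residual z‖ ^ 2 := by
    rw [← inner_sum, ← real_inner_self_eq_norm_sq]
    congr 1
    exact hr.symm
  have h2 : ∑ i, inner ℝ (∑ j, if i < j then d j else 0) (a i)
      = inner ℝ (∑ j : Fin m, d j.succ) (P.residual z)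
        - plus (z - xs) ⬝ᵥ P.M *ᵥ plus (z - y) := by
    rw [plus_dotProduct_M, hr, inner_sum]
    simp only [Pi.sub_apply]
    change _ = _ - ∑ i : Fin m, ∑ j : Fin m,
      if j ≤ i then inner ℝ (a i.succ) (d j.succ) else 0
    -- Row 0 contains all later increments. In row i ≥ 1 the missing indices are j ≤ i, which is the
    -- block lower triangle of M.
    rw [Fin.sum_univ_succ, Fin.sum_univ_succ (f := fun i => inner ℝ (∑ j : Fin m, d j.succ) (a i)),
      add_sub_assoc, ← Finset.sum_sub_distrib]
    congr 1
    · rw [Fin.sum_univ_succ]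
      simp [Fin.succ_pos]
    · refine Finset.sum_congr rfl fun i _ => ?_
      rw [Fin.sum_univ_succ]
      simp only [Fin.not_lt_zero, if_false, zero_add, sum_inner, Fin.succ_lt_succ_iff]
      rw [← Finset.sum_sub_distrib]
      refine Finset.sum_congr rfl fun j _ => ?_
      by_cases h : i < j
      · simp [h, h.not_ge]
      · simp [h, not_lt.1 h, real_inner_comm]
  rw [h1]
  change _ - ∑ i, inner ℝ (∑ j, if i < j then d j else 0) (a i) = _
  rw [h2]
  ring

end Problem

/-! ### Finiteness of the objective and saddle points. -/

namespace Problem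

variable {m N : ℕ} {n : Fin (m + 1) → ℕ} {P : Problem m N n}

/-- The real value of the objective, meaningful on the domain. -/
def realObjective (P : Problem m N n) (x : Blocks n) : ℝ :=
  ∑ i, (P.f i (x i) + (P.h i (x i)).toReal)

theorem Standing.objective_eq (hP : P.Standing) {x : Blocks n}
    (hx : ∀ i, x i ∈ dom (P.h i)) : P.objective x = (P.realObjective x : EReal) := by
  have hcoe : ∀ (s : Finset (Fin (m + 1))) (g : Fin (m + 1) → ℝ),
      ((∑ i ∈ s, g i : ℝ) : EReal) = ∑ i ∈ s, (g i : EReal) := fun s g => by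
    induction s using Finset.cons_induction with
    | empty => simp
    | cons a s ha ih => rw [Finset.sum_cons, Finset.sum_cons, EReal.coe_add, ih]
  rw [objective, realObjective, hcoe]
  refine Finset.sum_congr rfl fun i _ => ?_
  rw [EReal.coe_add, (hP.h_pcc i).coe_toReal (hx i)]

theorem Standing.mem_dom_of_objective_ne_top (hP : P.Standing) {x : Blocks n}
    (hx : P.objective x ≠ ⊤) (i : Fin (m + 1)) : x i ∈ dom (P.h i) := by
  intro htop
  apply hx
  rw [objective, ← Finset.add_sum_erase _ _ (Finset.mem_univ i), htop, EReal.coe_add_top]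
  -- In `EReal`, ⊤ + ⊥ = ⊥, so the other summands must be shown to differ from ⊥.
  apply EReal.top_add_of_ne_bot
  refine Finset.sum_induction _ (· ≠ ⊥) (fun a b ha hb => ?_) (by simp) fun j _ => ?_
  · simp [EReal.add_eq_bot_iff, ha, hb]
  · simp [EReal.add_eq_bot_iff, (hP.h_pcc j).ne_bot]

/-- Being a solution does not by itself give a finite objective, which could be ∞ on the whole
feasible set. Minimality of the Lagrangian over all points does: compare with any point of the
domain. -/
theorem Standing.mem_dom_of_pair (hP : P.Standing) {xs : Blocks n}
    {lams : EuclideanSpace ℝ (Fin N)} (hs : (xs, lams) ∈ P.solutionMultiplierPairs)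
    (i : Fin (m + 1)) : xs i ∈ dom (P.h i) := by
  choose w hw using fun i => (hP.h_pcc i).proper
  have h := hs.2 w
  simp only [lagrangian] at h
  rw [hP.objective_eq hw, ← EReal.coe_add] at h
  refine hP.mem_dom_of_objective_ne_top (fun htop => ?_) i
  rw [htop, EReal.top_add_coe] at h
  exact EReal.coe_ne_top _ (top_le_iff.1 h)

/-- The saddle-point inequality at a solution/multiplier pair. -/
theorem Standing.saddle (hP : P.Standing) {xs : Blocks n}
    {lams : EuclideanSpace ℝ (Fin N)} (hs : (xs, lams) ∈ P.solutionMultiplierPairs)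
    {z : Blocks n} (hz : ∀ i, z i ∈ dom (P.h i)) :
    0 ≤ P.realObjective z - P.realObjective xs + inner ℝ lams (P.residual z) := by
  have h := hs.2 z
  have hr : P.residual xs = 0 := hs.1.1
  simp only [lagrangian] at h
  rw [hP.objective_eq hz, hP.objective_eq (hP.mem_dom_of_pair hs), ← EReal.coe_add,
    ← EReal.coe_add, EReal.coe_le_coe_iff, hr, inner_zero_right] at h
  linarith

/-- Blockwise optimality together with feasibility gives a solution/multiplier pair. -/
theorem Standing.pair_of_blockwise (hP : P.Standing) {xs : Blocks n}
    {lams : EuclideanSpace ℝ (Fin N)} (hr : P.residual xs = 0)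
    (hmin : ∀ i, ∀ v ∈ dom (P.h i), P.h i (xs i) ≤ ((P.f i v + (P.h i v).toReal - P.f i (xs i)
      - inner ℝ lams (P.mulA i (xs i - v)) : ℝ) : EReal)) :
    (xs, lams) ∈ P.solutionMultiplierPairs := by
  have hdom : ∀ i, xs i ∈ dom (P.h i) := fun i => by
    obtain ⟨v, hv⟩ := (hP.h_pcc i).proper
    exact ne_top_of_le_ne_top (EReal.coe_ne_top _) (hmin i v hv)
  have hlag : ∀ w : Blocks n, P.lagrangian xs lams ≤ P.lagrangian w lams := by
    intro w
    by_cases hw : P.objective w = ⊤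
    · rw [lagrangian, lagrangian, hw, EReal.top_add_coe]
      exact le_top
    have hw' := hP.mem_dom_of_objective_ne_top hw
    simp only [lagrangian]
    rw [hP.objective_eq hdom, hP.objective_eq hw', ← EReal.coe_add, ← EReal.coe_add,
      EReal.coe_le_coe_iff, hr, inner_zero_right]
    have hres : P.residual w = - ∑ i, P.mulA i (xs i - w i) := by
      have : ∑ i, P.mulA i (xs i - w i) = P.residual xs - P.residual w := by
        simp [mulA_sub, residual]
      rw [this, hr, zero_sub, neg_neg]
    rw [hres, inner_neg_right, inner_sum, realObjective, realObjective, ← Finset.sum_neg_distrib,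
      ← Finset.sum_add_distrib, add_zero]
    refine Finset.sum_le_sum fun i _ => ?_
    have := hmin i (w i) (hw' i)
    rw [← (hP.h_pcc i).coe_toReal (hdom i), EReal.coe_le_coe_iff] at this
    linarith
  -- On feasible points the Lagrangian is the objective, so its minimality already contains
  -- optimality.
  refine ⟨⟨hr, fun w hw => ?_⟩, hlag⟩
  have := hlag w
  simpa [lagrangian, hr, hw] using this

end Problem

/-! ### Energy descent along the outer iterations. -/

theorem plus_sub {m : ℕ} {n : Fin (m + 1) → ℕ} (u v : Blocks n) :
    plus (u - v) = plus u - plus v := rfl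

namespace AcceleratedRun

variable {m N : ℕ} {n : Fin (m + 1) → ℕ} {P : Problem m N n} {par : Params} {ψ : ℝ≥0∞ → ℝ≥0∞}
  (R : AcceleratedRun P par ψ)

theorem Γ_pos {k : ℕ} (hk : 1 ≤ k) (i : Fin (m + 1)) : 0 < R.Γ k i := by
  rw [R.step1_Γ k hk i]
  exact (R.step1_loop k hk i).γ_pos (R.step1_loop k hk i).one_le_last

theorem Γ_le_succ {k : ℕ} (i : Fin (m + 1)) : R.Γ k i ≤ R.Γ (k + 1) i := by
  rw [R.step1_Γ (k + 1) (by omega) i]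
  exact (R.step1_loop (k + 1) (by omega) i).last_least.1.2.1

theorem inv_Γ_succ_le {k : ℕ} (hk : 1 ≤ k) (i : Fin (m + 1)) :
    (R.Γ (k + 1) i)⁻¹ ≤ (R.Γ k i)⁻¹ :=
  inv_anti₀ (R.Γ_pos hk i) (R.Γ_le_succ i)

theorem inv_Γ_le_one {k : ℕ} (hk : 1 ≤ k) (i : Fin (m + 1)) :
    (R.Γ k i)⁻¹ ≤ (R.Γ 1 i)⁻¹ := by
  induction k, hk using Nat.le_induction with
  | base => exact le_rfl
  | succ k hk ih => exact (R.inv_Γ_succ_le hk i).trans ih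

theorem r_nonneg {k : ℕ} (hk : 1 ≤ k) (i : Fin (m + 1)) : 0 ≤ R.r k i := by
  rw [R.step1_r k hk i]
  exact mul_nonneg (one_div_nonneg.2 (R.Γ_pos hk i).le) (Finset.sum_nonneg fun _ _ => sq_nonneg _)

/-- All inner loops of the run satisfy `δ α γ = 1`. -/
def Normalized : Prop :=
  ∀ k, 1 ≤ k → ∀ i, ∀ l, 1 ≤ l → (R.loop k i).δ l * (R.loop k i).α l * (R.loop k i).γ l = 1

variable {R}

theorem Normalized.z_mem_dom (hξ : R.Normalized) (hP : P.Standing) {k : ℕ} (hk : 1 ≤ k)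
    (i : Fin (m + 1)) : R.z k i ∈ dom (P.h i) := by
  rw [R.step1_z k hk i]
  exact (R.step1_loop k hk i).a_last_mem_dom hP (hξ k hk i)

/-- The estimate satisfied by block `i` at outer iteration `k`. -/
theorem Normalized.block_estimate (hξ : R.Normalized) (hP : P.Standing) {k : ℕ} (hk : 1 ≤ k)
    {i : Fin (m + 1)} {v : EuclideanSpace ℝ (Fin (n i))} (hv : v ∈ dom (P.h i)) :
    P.f i (R.z k i) + (P.h i (R.z k i)).toReal - P.f i v - (P.h i v).toReal
        + par.ρ * inner ℝ (P.mulA i (R.z k i) - P.blockRhs i (R.z k) (R.y k))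
          (P.mulA i (R.z k i - v))
        + inner ℝ (R.lam k) (P.mulA i (R.z k i - v)) ≤
      1 / 2 * ((R.Γ k i)⁻¹ * ‖v - R.x k i‖ ^ 2 - (R.Γ k i)⁻¹ * ‖v - R.x (k + 1) i‖ ^ 2
        - par.σ * R.r k i) := by
  have := (R.step1_loop k hk i).gap_last_le hP (hξ k hk i) hv
  rwa [← R.step1_Γ k hk i, ← R.step1_z k hk i, ← R.step1_x k hk i, ← R.step1_r k hk i] at this

variable (R) in
/-- The weighted distance of iterate `k` to `(xs, lams)`. -/
def energy (xs : Blocks n) (lams : EuclideanSpace ℝ (Fin N)) (G : Fin (m + 1) → ℝ) (k : ℕ) : ℝ :=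
  par.ρ⁻¹ * ‖R.lam k - lams‖ ^ 2 + par.ρ * (plus (R.y k - xs) ⬝ᵥ P.weight *ᵥ plus (R.y k - xs))
    + par.α * ∑ i, (G i)⁻¹ * ‖xs i - R.x k i‖ ^ 2

/-- The energy decreases along the run. -/
theorem Normalized.energy_descent (hξ : R.Normalized) (hP : P.Standing) {xs : Blocks n}
    {lams : EuclideanSpace ℝ (Fin N)} (hs : (xs, lams) ∈ P.solutionMultiplierPairs)
    {k : ℕ} (hk : 1 ≤ k) :
    R.energy xs lams (R.Γ k) (k + 1)
      + (par.α * par.ρ * (1 - par.α) * (‖P.residual (R.z k)‖ ^ 2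
          + plus (R.z k - R.y k) ⬝ᵥ P.H *ᵥ plus (R.z k - R.y k))
        + par.α * par.σ * ∑ i, R.r k i) ≤ R.energy xs lams (R.Γ k) k := by
  have hr : P.residual xs = 0 := hs.1.1
  have hα := par.α_mem.1
  have hρ := par.ρ_pos
  set z := R.z k with hz
  set y := R.y k with hy
  have hsum := Finset.sum_le_sum fun i (_ : i ∈ Finset.univ) =>
    hξ.block_estimate hP hk (hP.mem_dom_of_pair hs i)
  simp only [Finset.sum_add_distrib, Finset.sum_sub_distrib, ← Finset.mul_sum] at hsum
  rw [P.sum_inner_blockRhs hr, ← inner_sum] at hsum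
  have hres : ∑ i, P.mulA i (z i - xs i) = P.residual z := by
    have : ∑ i, P.mulA i (z i - xs i) = P.residual z - P.residual xs := by
      simp [Problem.mulA_sub, Problem.residual]
    rw [this, hr, sub_zero]
  rw [hres] at hsum
  have hsad := hP.saddle hs (hξ.z_mem_dom hP hk)
  simp only [Problem.realObjective, Finset.sum_add_distrib, ← hz] at hsad
  have hlam : ‖R.lam (k + 1) - lams‖ ^ 2 = ‖R.lam k - lams‖ ^ 2
      + 2 * (par.α * par.ρ) * (inner ℝ (R.lam k) (P.residual z) - inner ℝ lams (P.residual z))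
      + (par.α * par.ρ) ^ 2 * ‖P.residual z‖ ^ 2 := by
    have : R.lam (k + 1) - lams = (R.lam k - lams) + (par.α * par.ρ) • P.residual z := by
      rw [R.step3_lam k hk]; abel
    rw [this, norm_add_sq_real, inner_smul_right, inner_sub_left, norm_smul, mul_pow,
      Real.norm_eq_abs, sq_abs]
    ring
  have hyk : plus (R.y (k + 1) - xs) = plus (y - xs)
      + par.α • ((P.Mᵀ)⁻¹ *ᵥ (P.H *ᵥ plus (z - y))) := by
    rw [plus_sub, R.step3_y_plus k hk, plus_sub, plus_sub]; abel
  have hwt := hP.weight_update (plus (y - xs)) (plus (z - y)) par.α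
  rw [← hyk] at hwt
  have hM : plus (z - xs) ⬝ᵥ P.M *ᵥ plus (z - y) = plus (y - xs) ⬝ᵥ P.M *ᵥ plus (z - y)
      + plus (z - y) ⬝ᵥ P.M *ᵥ plus (z - y) := by
    rw [← add_dotProduct]
    congr 1
    rw [plus_sub, plus_sub, plus_sub]; abel
  have hMw := P.plus_dotProduct_M_self (z - y)
  simp only [Pi.sub_apply] at hMw
  set D := ∑ j : Fin m, P.mulA j.succ (z j.succ - y j.succ)
  -- The cross term −⟨D, Az − b⟩ is absorbed by ‖D − (Az − b)‖² ≥ 0. It uses half of ‖Az − b‖² and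
  -- the ½‖D‖² from the symmetric part of M; the other halves, less the α² terms of the updates,
  -- leave the factor 1 − α.
  have hsq : 0 ≤ ‖P.residual z‖ ^ 2 - 2 * inner ℝ D (P.residual z) + ‖D‖ ^ 2 := by
    have h1 := norm_sub_sq_real D (P.residual z)
    have h2 := sq_nonneg ‖D - P.residual z‖
    linarith
  rw [hM, hMw] at hsum
  simp only [energy]
  rw [hwt, hlam]
  set Hw := plus (z - y) ⬝ᵥ P.H *ᵥ plus (z - y)
  set yMw := plus (y - xs) ⬝ᵥ P.M *ᵥ plus (z - y)
  have hinv : par.ρ⁻¹ * (‖R.lam k - lams‖ ^ 2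
      + 2 * (par.α * par.ρ) * (inner ℝ (R.lam k) (P.residual z) - inner ℝ lams (P.residual z))
      + (par.α * par.ρ) ^ 2 * ‖P.residual z‖ ^ 2) = par.ρ⁻¹ * ‖R.lam k - lams‖ ^ 2
      + 2 * par.α * (inner ℝ (R.lam k) (P.residual z) - inner ℝ lams (P.residual z))
      + par.α ^ 2 * par.ρ * ‖P.residual z‖ ^ 2 := by
    field_simp
  rw [hinv]
  have h1 := mul_le_mul_of_nonneg_left (add_le_add hsum hsad) (by positivity : 0 ≤ 2 * par.α)
  have h2 := mul_nonneg (by positivity : 0 ≤ par.α * par.ρ) hsq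
  linarith

/-- The stopping test makes Γ_i^k nondecreasing in k, so passing to the new weights can only lower
the energy. This is why `energy` takes the weights separately from the iteration index. -/
theorem energy_succ_le (xs : Blocks n) (lams : EuclideanSpace ℝ (Fin N)) {k : ℕ} (hk : 1 ≤ k) :
    R.energy xs lams (R.Γ (k + 1)) (k + 1) ≤ R.energy xs lams (R.Γ k) (k + 1) := by
  have := par.α_mem.1.le
  simp only [energy]
  gcongr with i _
  · exact R.Γ_pos hk i
  · exact R.Γ_le_succ i

end AcceleratedRun

/-! ### Descent sequences and limits of block vectors. -/

theorem le_of_descent {E d : ℕ → ℝ} (hd : ∀ k, 1 ≤ k → 0 ≤ d k)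
    (h : ∀ k, 1 ≤ k → E (k + 1) + d k ≤ E k) {j k : ℕ} (hj : 1 ≤ j) (hjk : j ≤ k) :
    E k ≤ E j := by
  induction k, hjk using Nat.le_induction with
  | base => exact le_rfl
  | succ k hk ih => linarith [hd k (hj.trans hk), h k (hj.trans hk)]

/-- From index 1 on, E is nonincreasing and bounded below, hence convergent; d is squeezed by its
consecutive differences. -/
theorem tendsto_zero_of_descent {E d : ℕ → ℝ} (hE : ∀ k, 1 ≤ k → 0 ≤ E k)
    (hd : ∀ k, 1 ≤ k → 0 ≤ d k) (h : ∀ k, 1 ≤ k → E (k + 1) + d k ≤ E k) :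
    Tendsto d atTop (𝓝 0) := by
  have hanti : Antitone fun k => E (k + 1) := fun j k hjk =>
    le_of_descent hd h (by omega) (by omega)
  have hlim := tendsto_atTop_ciInf hanti ⟨0, by rintro _ ⟨k, rfl⟩; exact hE _ (by omega)⟩
  have hdiff := hlim.sub (hlim.comp (tendsto_add_atTop_nat 1))
  rw [sub_self] at hdiff
  rw [← tendsto_add_atTop_iff_nat 1]
  refine squeeze_zero (fun k => hd _ (by omega)) (fun k => ?_) hdiff
  have := h (k + 1) (by omega)
  simp only [Function.comp]
  linarith

theorem tendsto_zero_of_sq {α : Type*} {l : Filter α} {g : α → ℝ}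
    (h : Tendsto (fun k => g k ^ 2) l (𝓝 0)) :
    Tendsto g l (𝓝 0) := by
  have := (Real.continuous_sqrt.tendsto 0).comp h
  rw [Real.sqrt_zero] at this
  rw [tendsto_zero_iff_abs_tendsto_zero]
  refine this.congr fun k => ?_
  simp [Real.sqrt_sq_eq_abs]

theorem norm_add_add_sq_le {E : Type*} [SeminormedAddCommGroup E] (a b c : E) :
    ‖a + b + c‖ ^ 2 ≤ 3 * (‖a‖ ^ 2 + ‖b‖ ^ 2 + ‖c‖ ^ 2) := by
  refine (pow_le_pow_left₀ (norm_nonneg _) norm_add₃_le 2).trans ?_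
  nlinarith [sq_nonneg (‖a‖ - ‖b‖), sq_nonneg (‖b‖ - ‖c‖), sq_nonneg (‖a‖ - ‖c‖)]

namespace Problem

variable {m N : ℕ} {n : Fin (m + 1) → ℕ} {P : Problem m N n}

theorem Standing.tendsto_of_mulA (hP : P.Standing) {l : Filter ℕ} (i : Fin (m + 1))
    {v : ℕ → EuclideanSpace ℝ (Fin (n i))}
    (h : Tendsto (fun k => P.mulA i (v k)) l (𝓝 0)) : Tendsto v l (𝓝 0) := by
  obtain ⟨K, -, hK⟩ := hP.mulA_bound i
  rw [tendsto_zero_iff_norm_tendsto_zero] at h ⊢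
  refine squeeze_zero (fun k => norm_nonneg _) (fun k => hK (v k)) ?_
  simpa using h.const_mul K

theorem tendsto_mulA (i : Fin (m + 1)) {l : Filter ℕ} {v : ℕ → EuclideanSpace ℝ (Fin (n i))}
    (h : Tendsto v l (𝓝 0)) : Tendsto (fun k => P.mulA i (v k)) l (𝓝 0) := by
  have := ((P.continuous_mulA i).tendsto 0).comp h
  rwa [show P.mulA i 0 = 0 from map_zero _] at this

/-- Convergence of the first block follows from that of the others and of the residual. -/
theorem Standing.tendsto_of_residual (hP : P.Standing) {l : Filter ℕ} {u v : ℕ → Blocks n}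
    (hr : Tendsto (fun k => P.residual (u k) - P.residual (v k)) l (𝓝 0))
    (hs : ∀ j : Fin m, Tendsto (fun k => u k j.succ - v k j.succ) l (𝓝 0)) (i : Fin (m + 1)) :
    Tendsto (fun k => u k i - v k i) l (𝓝 0) := by
  refine Fin.cases ?_ hs i
  apply hP.tendsto_of_mulA
  have hsum : Tendsto (fun k => ∑ j : Fin m, P.mulA j.succ (u k j.succ - v k j.succ)) l
      (𝓝 0) := by
    simpa using tendsto_finsetSum Finset.univ fun j _ => tendsto_mulA (P := P) j.succ (hs j)
  have := hr.sub hsum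
  rw [sub_zero] at this
  refine this.congr fun k => ?_
  simp only [residual, Fin.sum_univ_succ, mulA_sub, Finset.sum_sub_distrib]
  abel

end Problem

theorem tendsto_plus_zero {m : ℕ} {n : Fin (m + 1) → ℕ} {l : Filter ℕ} {w : ℕ → Blocks n}
    (h : ∀ j : Fin m, Tendsto (fun k => w k j.succ) l (𝓝 0)) :
    Tendsto (fun k => plus (w k)) l (𝓝 0) := by
  rw [tendsto_pi_nhds]
  rintro ⟨j, s⟩
  have hc : Continuous fun v : EuclideanSpace ℝ (Fin (n j.succ)) => v s := by fun_prop
  exact (hc.tendsto 0).comp (h j)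

theorem tendsto_of_tendsto_plus_zero {m : ℕ} {n : Fin (m + 1) → ℕ} {l : Filter ℕ}
    {w : ℕ → Blocks n} (h : Tendsto (fun k => plus (w k)) l (𝓝 0)) (j : Fin m) :
    Tendsto (fun k => w k j.succ) l (𝓝 0) := by
  have hc := (PiLp.continuous_toLp 2 fun _ : Fin (n j.succ) => ℝ).tendsto 0
  refine (hc.comp (f := fun k => (w k j.succ).ofLp) ?_)
  rw [tendsto_pi_nhds] at h ⊢
  exact fun s => h ⟨j, s⟩

/-! ### Quantities that vanish along the run. -/

namespace AcceleratedRun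

variable {m N : ℕ} {n : Fin (m + 1) → ℕ} {P : Problem m N n} {par : Params} {ψ : ℝ≥0∞ → ℝ≥0∞}
  {R : AcceleratedRun P par ψ}

theorem weight_nonneg (hP : P.Standing) (v : (Σ i : Fin m, Fin (n i.succ)) → ℝ) :
    0 ≤ v ⬝ᵥ P.weight *ᵥ v := by
  simpa using hP.weight_posDef.posSemidef.dotProduct_mulVec_nonneg v

theorem H_nonneg (hP : P.Standing) (v : (Σ i : Fin m, Fin (n i.succ)) → ℝ) :
    0 ≤ v ⬝ᵥ P.H *ᵥ v := by
  simpa using hP.H_posDef.posSemidef.dotProduct_mulVec_nonneg v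

section Energy

variable (R) (xs : Blocks n) (lams : EuclideanSpace ℝ (Fin N))

theorem energy_parts_nonneg (hP : P.Standing) {j : ℕ} (hj : 1 ≤ j) (k : ℕ) :
    0 ≤ par.ρ⁻¹ * ‖R.lam k - lams‖ ^ 2
      ∧ 0 ≤ par.ρ * (plus (R.y k - xs) ⬝ᵥ P.weight *ᵥ plus (R.y k - xs))
      ∧ 0 ≤ par.α * ∑ i, (R.Γ j i)⁻¹ * ‖xs i - R.x k i‖ ^ 2 := by
  have hρ := par.ρ_pos
  refine ⟨by positivity, mul_nonneg hρ.le (weight_nonneg hP _),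
    mul_nonneg par.α_mem.1.le (Finset.sum_nonneg fun i _ => mul_nonneg ?_ (sq_nonneg _))⟩
  exact inv_nonneg.2 (R.Γ_pos hj i).le

theorem energy_nonneg (hP : P.Standing) {j : ℕ} (hj : 1 ≤ j) (k : ℕ) :
    0 ≤ R.energy xs lams (R.Γ j) k := by
  obtain ⟨h1, h2, h3⟩ := R.energy_parts_nonneg xs lams hP hj k
  exact add_nonneg (add_nonneg h1 h2) h3

theorem norm_lam_sq_le (hP : P.Standing) {k : ℕ} (hk : 1 ≤ k) :
    ‖R.lam k - lams‖ ^ 2 ≤ par.ρ * R.energy xs lams (R.Γ k) k := by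
  obtain ⟨-, h2, h3⟩ := R.energy_parts_nonneg xs lams hP hk k
  rw [← inv_mul_le_iff₀ par.ρ_pos, energy]
  linarith

theorem weight_le (hP : P.Standing) {k : ℕ} (hk : 1 ≤ k) :
    plus (R.y k - xs) ⬝ᵥ P.weight *ᵥ plus (R.y k - xs)
      ≤ par.ρ⁻¹ * R.energy xs lams (R.Γ k) k := by
  obtain ⟨h1, -, h3⟩ := R.energy_parts_nonneg xs lams hP hk k
  rw [← div_eq_inv_mul, le_div_iff₀' par.ρ_pos, energy]
  linarith

theorem inv_Γ_mul_le (hP : P.Standing) {k : ℕ} (hk : 1 ≤ k) (i : Fin (m + 1)) :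
    (R.Γ k i)⁻¹ * ‖xs i - R.x k i‖ ^ 2 ≤ par.α⁻¹ * R.energy xs lams (R.Γ k) k := by
  obtain ⟨h1, h2, -⟩ := R.energy_parts_nonneg xs lams hP hk k
  have h3 := Finset.single_le_sum (f := fun i => (R.Γ k i)⁻¹ * ‖xs i - R.x k i‖ ^ 2)
    (fun i _ => mul_nonneg (inv_nonneg.2 (R.Γ_pos hk i).le) (sq_nonneg _)) (Finset.mem_univ i)
  rw [← div_eq_inv_mul (R.energy _ _ _ _), le_div_iff₀' par.α_mem.1, energy]
  have := mul_le_mul_of_nonneg_left h3 par.α_mem.1.le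
  linarith

end Energy

namespace Normalized

theorem decrement_nonneg (hP : P.Standing) {k : ℕ} (hk : 1 ≤ k) :
    0 ≤ par.α * par.ρ * (1 - par.α) * (‖P.residual (R.z k)‖ ^ 2
          + plus (R.z k - R.y k) ⬝ᵥ P.H *ᵥ plus (R.z k - R.y k))
        + par.α * par.σ * ∑ i, R.r k i := by
  have h1 := par.α_mem.1
  have h2 := sub_pos.2 par.α_mem.2
  have h3 := par.ρ_pos
  have h4 := par.σ_mem.1
  have h5 := H_nonneg hP (plus (R.z k - R.y k))
  have h6 := Finset.sum_nonneg fun i (_ : i ∈ Finset.univ) => R.r_nonneg hk i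
  positivity

theorem energy_step
    (hξ : R.Normalized) (hP : P.Standing) {xs : Blocks n} {lams : EuclideanSpace ℝ (Fin N)}
    (hs : (xs, lams) ∈ P.solutionMultiplierPairs)
    {k : ℕ} (hk : 1 ≤ k) :
    R.energy xs lams (R.Γ (k + 1)) (k + 1)
      + (par.α * par.ρ * (1 - par.α) * (‖P.residual (R.z k)‖ ^ 2
          + plus (R.z k - R.y k) ⬝ᵥ P.H *ᵥ plus (R.z k - R.y k))
        + par.α * par.σ * ∑ i, R.r k i) ≤ R.energy xs lams (R.Γ k) k := by
  have h1 := hξ.energy_descent hP hs hk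
  have h2 := R.energy_succ_le xs lams hk
  linarith

theorem energy_le
    (hξ : R.Normalized) (hP : P.Standing) {xs : Blocks n} {lams : EuclideanSpace ℝ (Fin N)}
    (hs : (xs, lams) ∈ P.solutionMultiplierPairs)
    {j k : ℕ} (hj : 1 ≤ j) (hjk : j ≤ k) :
    R.energy xs lams (R.Γ k) k ≤ R.energy xs lams (R.Γ j) j :=
  le_of_descent (E := fun k => R.energy xs lams (R.Γ k) k)
    (fun _ hk => decrement_nonneg hP hk) (fun _ hk => hξ.energy_step hP hs hk) hj hjk

theorem tendsto_decrement
    (hξ : R.Normalized) (hP : P.Standing) {xs : Blocks n} {lams : EuclideanSpace ℝ (Fin N)}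
    (hs : (xs, lams) ∈ P.solutionMultiplierPairs) :
    Tendsto (fun k => par.α * par.ρ * (1 - par.α) * (‖P.residual (R.z k)‖ ^ 2
          + plus (R.z k - R.y k) ⬝ᵥ P.H *ᵥ plus (R.z k - R.y k))
        + par.α * par.σ * ∑ i, R.r k i) atTop (𝓝 0) :=
  tendsto_zero_of_descent (E := fun k => R.energy xs lams (R.Γ k) k)
    (fun k hk => R.energy_nonneg xs lams hP hk k)
    (fun _ hk => decrement_nonneg hP hk) (fun _ hk => hξ.energy_step hP hs hk)

theorem tendsto_of_le_decrement
    (hξ : R.Normalized) (hP : P.Standing) {xs : Blocks n} {lams : EuclideanSpace ℝ (Fin N)}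
    (hs : (xs, lams) ∈ P.solutionMultiplierPairs)
    {g : ℕ → ℝ} {C : ℝ} (hg : ∀ k, 1 ≤ k → 0 ≤ g k) (hC : 0 < C)
    (h : ∀ k, 1 ≤ k → C * g k ≤ par.α * par.ρ * (1 - par.α) * (‖P.residual (R.z k)‖ ^ 2
          + plus (R.z k - R.y k) ⬝ᵥ P.H *ᵥ plus (R.z k - R.y k))
        + par.α * par.σ * ∑ i, R.r k i) : Tendsto g atTop (𝓝 0) := by
  have := (hξ.tendsto_decrement hP hs).const_mul C⁻¹
  rw [mul_zero] at this
  refine squeeze_zero' ((eventually_ge_atTop 1).mono hg)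
    ((eventually_ge_atTop 1).mono fun k hk => ?_) this
  rw [← div_eq_inv_mul, le_div_iff₀' hC]
  exact h k hk

theorem tendsto_residual
    (hξ : R.Normalized) (hP : P.Standing) {xs : Blocks n} {lams : EuclideanSpace ℝ (Fin N)}
    (hs : (xs, lams) ∈ P.solutionMultiplierPairs) :
    Tendsto (fun k => P.residual (R.z k)) atTop (𝓝 0) := by
  have h1 := par.α_mem.1
  have h2 := sub_pos.2 par.α_mem.2
  have h3 := par.ρ_pos
  have h4 := par.σ_mem.1
  rw [tendsto_zero_iff_norm_tendsto_zero]
  refine tendsto_zero_of_sq (hξ.tendsto_of_le_decrement hP hs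
    (C := par.α * par.ρ * (1 - par.α)) (fun k _ => sq_nonneg _) (by positivity) fun k hk => ?_)
  have h5 := H_nonneg hP (plus (R.z k - R.y k))
  have h6 := Finset.sum_nonneg fun i (_ : i ∈ Finset.univ) => R.r_nonneg hk i
  rw [mul_add]
  have : 0 ≤ par.α * par.ρ * (1 - par.α)
    * (plus (R.z k - R.y k) ⬝ᵥ P.H *ᵥ plus (R.z k - R.y k)) := by positivity
  have : 0 ≤ par.α * par.σ * ∑ i, R.r k i := by positivity
  linarith

theorem tendsto_sum_r
    (hξ : R.Normalized) (hP : P.Standing) {xs : Blocks n} {lams : EuclideanSpace ℝ (Fin N)}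
    (hs : (xs, lams) ∈ P.solutionMultiplierPairs) :
    Tendsto (fun k => ∑ i, R.r k i) atTop (𝓝 0) := by
  have h1 := par.α_mem.1
  have h2 := sub_pos.2 par.α_mem.2
  have h3 := par.ρ_pos
  have h4 := par.σ_mem.1
  refine hξ.tendsto_of_le_decrement hP hs (C := par.α * par.σ)
    (fun k hk => Finset.sum_nonneg fun i (_ : i ∈ Finset.univ) => R.r_nonneg hk i)
    (by positivity) fun k hk => ?_
  have h5 := H_nonneg hP (plus (R.z k - R.y k))
  have : 0 ≤ par.α * par.ρ * (1 - par.α) * (‖P.residual (R.z k)‖ ^ 2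
    + plus (R.z k - R.y k) ⬝ᵥ P.H *ᵥ plus (R.z k - R.y k)) := by positivity
  linarith

theorem tendsto_z_sub_y_succ
    (hξ : R.Normalized) (hP : P.Standing) {xs : Blocks n} {lams : EuclideanSpace ℝ (Fin N)}
    (hs : (xs, lams) ∈ P.solutionMultiplierPairs)
    (j : Fin m) :
    Tendsto (fun k => R.z k j.succ - R.y k j.succ) atTop (𝓝 0) := by
  have h1 := par.α_mem.1
  have h2 := sub_pos.2 par.α_mem.2
  have h3 := par.ρ_pos
  have h4 := par.σ_mem.1
  apply hP.tendsto_of_mulA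
  rw [tendsto_zero_iff_norm_tendsto_zero]
  refine tendsto_zero_of_sq (hξ.tendsto_of_le_decrement hP hs
    (C := par.α * par.ρ * (1 - par.α)) (fun k _ => sq_nonneg _) (by positivity) fun k hk => ?_)
  have h5 := Finset.single_le_sum
    (f := fun j : Fin m => ‖P.mulA j.succ ((R.z k - R.y k) j.succ)‖ ^ 2)
    (fun _ _ => sq_nonneg _) (Finset.mem_univ j)
  rw [← P.plus_dotProduct_H_self] at h5
  have h6 := Finset.sum_nonneg fun i (_ : i ∈ Finset.univ) => R.r_nonneg hk i
  have h7 : 0 ≤ par.α * par.ρ * (1 - par.α) * ‖P.residual (R.z k)‖ ^ 2 := by positivity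
  have h8 : 0 ≤ par.α * par.σ * ∑ i, R.r k i := by positivity
  have h9 := mul_le_mul_of_nonneg_left h5 (by positivity : 0 ≤ par.α * par.ρ * (1 - par.α))
  simp only [Pi.sub_apply] at h9
  rw [mul_add]
  linarith

theorem tendsto_plus_z_sub_y
    (hξ : R.Normalized) (hP : P.Standing) {xs : Blocks n} {lams : EuclideanSpace ℝ (Fin N)}
    (hs : (xs, lams) ∈ P.solutionMultiplierPairs) :
    Tendsto (fun k => plus (R.z k - R.y k)) atTop (𝓝 0) :=
  tendsto_plus_zero fun j => hξ.tendsto_z_sub_y_succ hP hs j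

theorem tendsto_e
    (hξ : R.Normalized) (hP : P.Standing) {xs : Blocks n} {lams : EuclideanSpace ℝ (Fin N)}
    (hs : (xs, lams) ∈ P.solutionMultiplierPairs) : Tendsto R.e atTop (𝓝 0) := by
  have h1 := (((PiLp.continuous_toLp 2 _).tendsto 0).comp (hξ.tendsto_plus_z_sub_y hP hs)).norm
  have h2 := (hξ.tendsto_residual hP hs).norm
  have h3 := (Real.continuous_sqrt.tendsto 0).comp (hξ.tendsto_sum_r hP hs)
  have h4 := ((h1.const_mul par.θ₁).add (h2.const_mul par.θ₂)).add (h3.const_mul par.θ₃)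
  have h5 := ENNReal.tendsto_ofReal h4
  simp only [WithLp.toLp_zero, norm_zero, mul_zero, Real.sqrt_zero, add_zero,
    ENNReal.ofReal_zero] at h5
  refine h5.congr' ((eventually_ge_atTop 1).mono fun k hk => ?_)
  rw [R.step2_e k hk]
  rfl

/-- The stopping test bounds this step by ψ(e^{k−1}), and continuity of ψ at 0 suffices because e^k
→ 0. The shift by one accounts for the previous error. -/
theorem tendsto_last_step
    (hξ : R.Normalized) (hP : P.Standing) {xs : Blocks n} {lams : EuclideanSpace ℝ (Fin N)}
    (hs : (xs, lams) ∈ P.solutionMultiplierPairs)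
    (hψ : IsTolerance ψ) (i : Fin (m + 1)) :
    Tendsto (fun k => ‖(R.loop k i).a (R.loop k i).last
      - (R.loop k i).a ((R.loop k i).last - 1)‖) atTop (𝓝 0) := by
  have h1 : Tendsto (fun k => ψ (R.e k)) atTop (𝓝 0) := by
    have := hψ.cont.tendsto.comp (hξ.tendsto_e hP hs)
    rwa [hψ.zero] at this
  rw [← tendsto_add_atTop_iff_nat 1]
  have h2 : Tendsto (fun k => ENNReal.ofReal ‖(R.loop (k + 1) i).a (R.loop (k + 1) i).last
      - (R.loop (k + 1) i).a ((R.loop (k + 1) i).last - 1)‖) atTop (𝓝 0) := by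
    refine tendsto_of_tendsto_of_tendsto_of_le_of_le tendsto_const_nhds h1
      (fun _ => zero_le) fun k => ?_
    exact (R.step1_loop (k + 1) (by omega) i).last_least.1.2.2
  have h3 := (ENNReal.tendsto_toReal ENNReal.zero_ne_top).comp h2
  simpa [Function.comp_def] using h3

/-- Only the distance weighted by (Γ_i^k)⁻¹ is controlled, as Γ_i^k may be unbounded; it is also the
only one the energy needs. -/
theorem tendsto_x_sub_z
    (hξ : R.Normalized) (hP : P.Standing) {xs : Blocks n} {lams : EuclideanSpace ℝ (Fin N)}
    (hs : (xs, lams) ∈ P.solutionMultiplierPairs)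
    (hψ : IsTolerance ψ) {κ : ℝ} (hκ : 0 < κ)
    (hκγ : ∀ k, 1 ≤ k → ∀ i, ∀ l, 1 ≤ l → κ ≤ (R.loop k i).γ l * (R.loop k i).α l ^ 2)
    (i : Fin (m + 1)) :
    Tendsto (fun k => (R.Γ k i)⁻¹ * ‖R.x (k + 1) i - R.z k i‖ ^ 2) atTop (𝓝 0) := by
  have h1 := ((hξ.tendsto_last_step hP hs hψ i).pow 2).div_const κ
  simp only [ne_eq, OfNat.ofNat_ne_zero, not_false_eq_true, zero_pow, zero_div] at h1
  refine squeeze_zero' ((eventually_ge_atTop 1).mono fun k hk =>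
    mul_nonneg (inv_nonneg.2 (R.Γ_pos hk i).le) (sq_nonneg _))
    ((eventually_ge_atTop 1).mono fun k hk => ?_) h1
  rw [R.step1_Γ k hk i, R.step1_x k hk i, R.step1_z k hk i]
  exact (R.step1_loop k hk i).dist_u_a_last_le hκ (hκγ k hk i)

/-- For the later blocks, the increment of y₊ is a fixed linear image of z₊ − y₊, which vanishes.
The first block follows from the residual and injectivity of its matrix. -/
theorem tendsto_z_succ_sub_z
    (hξ : R.Normalized) (hP : P.Standing) {xs : Blocks n} {lams : EuclideanSpace ℝ (Fin N)}
    (hs : (xs, lams) ∈ P.solutionMultiplierPairs)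
    (i : Fin (m + 1)) :
    Tendsto (fun k => R.z (k + 1) i - R.z k i) atTop (𝓝 0) := by
  have hr := hξ.tendsto_residual hP hs
  have hr' := ((tendsto_add_atTop_iff_nat 1).2 hr).sub hr
  rw [sub_zero] at hr'
  refine hP.tendsto_of_residual (u := fun k => R.z (k + 1)) (v := R.z) hr' (fun j => ?_) i
  have hy : Tendsto (fun k => R.y (k + 1) j.succ - R.y k j.succ) atTop (𝓝 0) := by
    refine tendsto_of_tendsto_plus_zero (w := fun k => R.y (k + 1) - R.y k) ?_ j
    have hc : Continuous fun v => par.α • ((P.Mᵀ)⁻¹ *ᵥ (P.H *ᵥ v)) := by fun_prop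
    have := (hc.tendsto 0).comp (hξ.tendsto_plus_z_sub_y hP hs)
    simp only [Matrix.mulVec_zero, smul_zero] at this
    refine this.congr' ((eventually_ge_atTop 1).mono fun k hk => ?_)
    change _ = plus (R.y (k + 1)) - plus (R.y k)
    rw [R.step3_y_plus k hk, ← plus_sub]
    simp
  have hz := hξ.tendsto_z_sub_y_succ hP hs j
  have := (((tendsto_add_atTop_iff_nat 1).2 hz).add hy).sub hz
  simp only [add_zero, sub_zero] at this
  refine this.congr fun k => ?_
  abel

theorem tendsto_z_sub_y
    (hξ : R.Normalized) (hP : P.Standing) {xs : Blocks n} {lams : EuclideanSpace ℝ (Fin N)}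
    (hs : (xs, lams) ∈ P.solutionMultiplierPairs)
    (i : Fin (m + 1)) :
    Tendsto (fun k => R.z k i - R.y k i) atTop (𝓝 0) := by
  refine Fin.cases ?_ (fun j => hξ.tendsto_z_sub_y_succ hP hs j) i
  rw [← tendsto_add_atTop_iff_nat 1]
  refine (hξ.tendsto_z_succ_sub_z hP hs 0).congr'
    ((eventually_ge_atTop 1).mono fun k hk => ?_)
  -- Since y_1^{k+1} = z_1^k, the difference for the first block is a successive difference of z.
  simp only [R.step3_y_first k hk]

/-! ### Boundedness and cluster points. -/

theorem isBigO_y_succ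
    (hξ : R.Normalized) (hP : P.Standing) {xs : Blocks n} {lams : EuclideanSpace ℝ (Fin N)}
    (hs : (xs, lams) ∈ P.solutionMultiplierPairs)
    (j : Fin m) :
    (fun k => R.y k j.succ - xs j.succ) =O[atTop] (fun _ => (1 : ℝ)) := by
  obtain ⟨C, hC, hb⟩ := exists_sq_le_of_posDef hP.weight_posDef
  set B := C * (par.ρ⁻¹ * R.energy xs lams (R.Γ 1) 1) with hB
  refine Asymptotics.IsBigO.of_bound (Real.sqrt (n j.succ * B))
    ((eventually_ge_atTop 1).mono fun k hk => ?_)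
  rw [norm_one, mul_one]
  refine Real.le_sqrt_of_sq_le ?_
  rw [EuclideanSpace.norm_sq_eq]
  refine (Finset.sum_le_card_nsmul Finset.univ _ B fun s _ => ?_).trans (by simp)
  rw [Real.norm_eq_abs, sq_abs]
  refine (hb (plus (R.y k - xs)) ⟨j, s⟩).trans (mul_le_mul_of_nonneg_left ?_ hC.le)
  refine (R.weight_le xs lams hP hk).trans
    (mul_le_mul_of_nonneg_left (hξ.energy_le hP hs le_rfl hk) (inv_nonneg.2 par.ρ_pos.le))

theorem isBigO_z
    (hξ : R.Normalized) (hP : P.Standing) {xs : Blocks n} {lams : EuclideanSpace ℝ (Fin N)}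
    (hs : (xs, lams) ∈ P.solutionMultiplierPairs)
    (i : Fin (m + 1)) :
    (fun k => R.z k i) =O[atTop] (fun _ => (1 : ℝ)) := by
  have hsucc : ∀ j : Fin m, (fun k => R.z k j.succ) =O[atTop] (fun _ => (1 : ℝ)) := fun j => by
    have h1 := ((hξ.tendsto_z_sub_y hP hs j.succ).isBigO_one ℝ).add (hξ.isBigO_y_succ hP hs j)
    have h2 := h1.add (Asymptotics.isBigO_const_const (xs j.succ) (one_ne_zero (α := ℝ)) atTop)
    refine h2.congr_left fun k => ?_
    abel
  refine Fin.cases ?_ hsucc i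
  obtain ⟨K, -, hK⟩ := hP.mulA_bound 0
  -- The energy says nothing about z in the first block; z is bounded there because A₁z₁ equals the
  -- residual plus b minus the other blocks.
  have h1 : (fun k => R.z k 0) =O[atTop] (fun k => P.mulA 0 (R.z k 0)) :=
    Asymptotics.IsBigO.of_bound K (Eventually.of_forall fun k => hK _)
  refine h1.trans ?_
  have h2 : (fun k => ∑ j : Fin m, P.mulA j.succ (R.z k j.succ)) =O[atTop]
      (fun _ => (1 : ℝ)) := by
    refine Asymptotics.IsBigO.fun_sum fun j _ => ?_
    have h : (fun k => P.mulA j.succ (R.z k j.succ)) =O[atTop] (fun k => R.z k j.succ) :=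
      ContinuousLinearMap.isBigO_comp
        (LinearMap.toContinuousLinearMap (Matrix.toEuclideanLin (P.A j.succ))) _ _
    exact h.trans (hsucc j)
  have h3 := (((hξ.tendsto_residual hP hs).isBigO_one ℝ).add
    (Asymptotics.isBigO_const_const P.b (one_ne_zero (α := ℝ)) atTop)).sub h2
  refine h3.congr_left fun k => ?_
  rw [Problem.residual, Fin.sum_univ_succ]
  abel

theorem isBigO_lam
    (hξ : R.Normalized) (hP : P.Standing) {xs : Blocks n} {lams : EuclideanSpace ℝ (Fin N)}
    (hs : (xs, lams) ∈ P.solutionMultiplierPairs) : R.lam =O[atTop] (fun _ => (1 : ℝ)) := by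
  have h1 : (fun k => R.lam k - lams) =O[atTop] (fun _ => (1 : ℝ)) := by
    refine Asymptotics.IsBigO.of_bound (Real.sqrt (par.ρ * R.energy xs lams (R.Γ 1) 1))
      ((eventually_ge_atTop 1).mono fun k hk => ?_)
    rw [norm_one, mul_one]
    refine Real.le_sqrt_of_sq_le ((R.norm_lam_sq_le xs lams hP hk).trans
      (mul_le_mul_of_nonneg_left (hξ.energy_le hP hs le_rfl hk) par.ρ_pos.le))
  refine (h1.add (Asymptotics.isBigO_const_const lams (one_ne_zero (α := ℝ)) atTop)).congr_left
    fun k => ?_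
  abel

/-- The iterates `(z, lam)` have a cluster point. -/
theorem exists_cluster
    (hξ : R.Normalized) (hP : P.Standing) {xs : Blocks n} {lams : EuclideanSpace ℝ (Fin N)}
    (hs : (xs, lams) ∈ P.solutionMultiplierPairs) :
    ∃ (zs : Blocks n) (mu : EuclideanSpace ℝ (Fin N)) (φ : ℕ → ℕ),
    StrictMono φ ∧ Tendsto (fun j => R.z (φ j)) atTop (𝓝 zs)
      ∧ Tendsto (fun j => R.lam (φ j)) atTop (𝓝 mu) := by
  have hO : (fun k => (R.z k, R.lam k)) =O[atTop] (fun _ => (1 : ℝ)) :=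
    (Asymptotics.isBigO_pi.2 fun i => hξ.isBigO_z hP hs i).prod_left (hξ.isBigO_lam hP hs)
  obtain ⟨C, hC⟩ := hO.bound
  obtain ⟨⟨zs, mu⟩, -, φ, hφ, hlim⟩ := tendsto_subseq_of_frequently_bounded
    (Metric.isBounded_closedBall (x := (0 : Blocks n × EuclideanSpace ℝ (Fin N))) (r := C))
    (x := fun k => (R.z k, R.lam k)) (hC.mono fun k hk => by simpa using hk).frequently
  rw [nhds_prod_eq, tendsto_prod_iff'] at hlim
  exact ⟨zs, mu, φ, hφ, hlim.1, hlim.2⟩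

/-! ### Optimality of cluster points. -/

theorem tendsto_x_succ_sub_x
    (hξ : R.Normalized) (hP : P.Standing) {xs : Blocks n} {lams : EuclideanSpace ℝ (Fin N)}
    (hs : (xs, lams) ∈ P.solutionMultiplierPairs)
    (hψ : IsTolerance ψ) {κ : ℝ} (hκ : 0 < κ)
    (hκγ : ∀ k, 1 ≤ k → ∀ i, ∀ l, 1 ≤ l → κ ≤ (R.loop k i).γ l * (R.loop k i).α l ^ 2)
    (i : Fin (m + 1)) :
    Tendsto (fun k => (R.Γ k i)⁻¹ * ‖R.x (k + 1) i - R.x k i‖ ^ 2) atTop (𝓝 0) := by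
  have h1 := hξ.tendsto_x_sub_z hP hs hψ hκ hκγ i
  have h2 := ((hξ.tendsto_z_succ_sub_z hP hs i).norm.pow 2).const_mul (R.Γ 1 i)⁻¹
  simp only [norm_zero, ne_eq, OfNat.ofNat_ne_zero, not_false_eq_true, zero_pow, mul_zero] at h2
  rw [← tendsto_add_atTop_iff_nat 1]
  have h3 := ((((tendsto_add_atTop_iff_nat 1).2 h1).add h2).add h1).const_mul 3
  simp only [add_zero, mul_zero] at h3
  refine squeeze_zero' (Eventually.of_forall fun k =>
    mul_nonneg (inv_nonneg.2 (R.Γ_pos (by omega) i).le) (sq_nonneg _))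
    ((eventually_ge_atTop 1).mono fun k hk => ?_) h3
  have hG := inv_nonneg.2 (R.Γ_pos (k := k + 1) (by omega) i).le
  -- The path from x^{k+2} to x^{k+1} goes through z^{k+1} and z^k; monotonicity of Γ adjusts the
  -- weight on the last leg.
  have e2 := norm_add_add_sq_le (R.x (k + 1 + 1) i - R.z (k + 1) i) (R.z (k + 1) i - R.z k i)
    (R.z k i - R.x (k + 1) i)
  rw [sub_add_sub_cancel, sub_add_sub_cancel, norm_sub_rev (R.z k i)] at e2
  have e3 := mul_le_mul_of_nonneg_left e2 hG
  have e4 := mul_le_mul_of_nonneg_right (R.inv_Γ_le_one (k := k + 1) (by omega) i)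
    (sq_nonneg ‖R.z (k + 1) i - R.z k i‖)
  have e5 := mul_le_mul_of_nonneg_right (R.inv_Γ_succ_le hk i)
    (sq_nonneg ‖R.x (k + 1) i - R.z k i‖)
  linarith

/-- With p = v − x^k and q = x^{k+1} − x^k, the difference is at most 2Γ⁻¹‖p‖‖q‖. The energy bounds
Γ⁻¹‖p‖² by a constant, and Γ⁻¹‖q‖² tends to 0, so Cauchy–Schwarz finishes. A one-sided bound
suffices for optimality. -/
theorem tendsto_distance_gap
    (hξ : R.Normalized) (hP : P.Standing) {xs : Blocks n} {lams : EuclideanSpace ℝ (Fin N)}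
    (hs : (xs, lams) ∈ P.solutionMultiplierPairs)
    (hψ : IsTolerance ψ) {κ : ℝ} (hκ : 0 < κ)
    (hκγ : ∀ k, 1 ≤ k → ∀ i, ∀ l, 1 ≤ l → κ ≤ (R.loop k i).γ l * (R.loop k i).α l ^ 2)
    (i : Fin (m + 1)) (v : EuclideanSpace ℝ (Fin (n i))) :
    ∃ g : ℕ → ℝ, Tendsto g atTop (𝓝 0) ∧ ∀ k, 1 ≤ k →
      (R.Γ k i)⁻¹ * ‖v - R.x k i‖ ^ 2 - (R.Γ k i)⁻¹ * ‖v - R.x (k + 1) i‖ ^ 2 ≤ g k := by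
  set C := 2 * ((R.Γ 1 i)⁻¹ * ‖v - xs i‖ ^ 2)
    + 2 * (par.α⁻¹ * R.energy xs lams (R.Γ 1) 1) with hC
  refine ⟨fun k => 2 * (Real.sqrt C
    * Real.sqrt ((R.Γ k i)⁻¹ * ‖R.x (k + 1) i - R.x k i‖ ^ 2)), ?_, fun k hk => ?_⟩
  · have := (Real.continuous_sqrt.tendsto 0).comp
      (hξ.tendsto_x_succ_sub_x hP hs hψ hκ hκγ i)
    rw [Real.sqrt_zero] at this
    simpa using (this.const_mul (Real.sqrt C)).const_mul 2
  · have hG := inv_nonneg.2 (R.Γ_pos hk i).le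
    set G := (R.Γ k i)⁻¹ with hGdef
    set p := v - R.x k i with hp
    set q := R.x (k + 1) i - R.x k i with hq
    have hsub : v - R.x (k + 1) i = p - q := by rw [hp, hq]; abel
    have hpC : G * ‖p‖ ^ 2 ≤ C := by
      have e1 : ‖p‖ ≤ ‖v - xs i‖ + ‖xs i - R.x k i‖ := norm_sub_le_norm_sub_add_norm_sub _ _ _
      have e2 : ‖p‖ ^ 2 ≤ 2 * ‖v - xs i‖ ^ 2 + 2 * ‖xs i - R.x k i‖ ^ 2 := by
        nlinarith [norm_nonneg p, sq_nonneg (‖v - xs i‖ - ‖xs i - R.x k i‖)]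
      have e3 := (R.inv_Γ_mul_le xs lams hP hk i).trans
        (mul_le_mul_of_nonneg_left (hξ.energy_le hP hs le_rfl hk) (inv_nonneg.2 par.α_mem.1.le))
      have e4 := mul_le_mul_of_nonneg_right (R.inv_Γ_le_one hk i) (sq_nonneg ‖v - xs i‖)
      have e5 := mul_le_mul_of_nonneg_left e2 hG
      rw [hC]
      linarith
    have h1 : ‖p‖ ^ 2 - ‖p - q‖ ^ 2 ≤ 2 * (‖p‖ * ‖q‖) := by
      rw [norm_sub_sq_real p q]
      nlinarith [real_inner_le_norm p q, sq_nonneg ‖q‖]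
    have h2 : G * (‖p‖ * ‖q‖) = Real.sqrt (G * ‖p‖ ^ 2) * Real.sqrt (G * ‖q‖ ^ 2) := by
      rw [Real.sqrt_mul hG, Real.sqrt_mul hG, Real.sqrt_sq (norm_nonneg _),
        Real.sqrt_sq (norm_nonneg _)]
      nlinarith [Real.mul_self_sqrt hG]
    have h3 : G * (‖p‖ * ‖q‖) ≤ Real.sqrt C * Real.sqrt (G * ‖q‖ ^ 2) := by
      rw [h2]
      gcongr
    have h4 := mul_le_mul_of_nonneg_left h1 hG
    rw [hsub]
    linarith

/-- Cluster points are solution/multiplier pairs. -/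
theorem cluster_mem
    (hξ : R.Normalized) (hP : P.Standing) {xs : Blocks n} {lams : EuclideanSpace ℝ (Fin N)}
    (hs : (xs, lams) ∈ P.solutionMultiplierPairs)
    (hψ : IsTolerance ψ) {κ : ℝ} (hκ : 0 < κ)
    (hκγ : ∀ k, 1 ≤ k → ∀ i, ∀ l, 1 ≤ l → κ ≤ (R.loop k i).γ l * (R.loop k i).α l ^ 2)
    {zs : Blocks n} {mu : EuclideanSpace ℝ (Fin N)} {φ : ℕ → ℕ} (hφ : StrictMono φ)
    (hz : Tendsto (fun j => R.z (φ j)) atTop (𝓝 zs))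
    (hlam : Tendsto (fun j => R.lam (φ j)) atTop (𝓝 mu)) :
    (zs, mu) ∈ P.solutionMultiplierPairs := by
  have hφt := hφ.tendsto_atTop
  have hzi : ∀ i, Tendsto (fun j => R.z (φ j) i) atTop (𝓝 (zs i)) := tendsto_pi_nhds.1 hz
  have hyi : ∀ i, Tendsto (fun j => R.y (φ j) i) atTop (𝓝 (zs i)) := fun i => by
    have := (hzi i).sub ((hξ.tendsto_z_sub_y hP hs i).comp hφt)
    rw [sub_zero] at this
    refine this.congr fun j => ?_
    simp
  have hAz : ∀ i, Tendsto (fun j => P.mulA i (R.z (φ j) i)) atTop (𝓝 (P.mulA i (zs i))) :=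
    fun i => ((P.continuous_mulA i).tendsto _).comp (hzi i)
  have hAy : ∀ i, Tendsto (fun j => P.mulA i (R.y (φ j) i)) atTop (𝓝 (P.mulA i (zs i))) :=
    fun i => ((P.continuous_mulA i).tendsto _).comp (hyi i)
  have hres : P.residual zs = 0 := by
    refine tendsto_nhds_unique (f := fun j => P.residual (R.z (φ j))) ?_
      ((hξ.tendsto_residual hP hs).comp hφt)
    exact (tendsto_finsetSum _ fun i _ => hAz i).sub_const P.b
  refine hP.pair_of_blockwise hres fun i v hv => ?_
  obtain ⟨g, hg, hgle⟩ := hξ.tendsto_distance_gap hP hs hψ hκ hκγ i v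
  -- As z and y have the same limit `zs`, the penalty residual of each block tends to the residual
  -- of `zs`, which is 0.
  have hrhs : Tendsto (fun j => P.mulA i (R.z (φ j) i) - P.blockRhs i (R.z (φ j)) (R.y (φ j)))
      atTop (𝓝 0) := by
    have h1 := (hAz i).sub ((tendsto_const_nhds (x := P.b)).sub
      (tendsto_finsetSum (Finset.Iio i) fun j _ => hAz j) |>.sub
      (tendsto_finsetSum (Finset.Ioi i) fun j _ => hAy j))
    have h2 := P.sum_mulA_eq zs i
    rw [Problem.residual, h2] at hres
    refine (h1.congr fun j => rfl).trans (le_of_eq (congrArg 𝓝 ?_))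
    rw [← hres]
    abel
  have hAv : Tendsto (fun j => P.mulA i (R.z (φ j) i - v)) atTop (𝓝 (P.mulA i (zs i - v))) :=
    ((P.continuous_mulA i).tendsto _).comp ((hzi i).sub_const v)
  have hf : Tendsto (fun j => P.f i (R.z (φ j) i)) atTop (𝓝 (P.f i (zs i))) :=
    ((hP.f_diff i).continuous.tendsto _).comp (hzi i)
  -- The block estimate is solved for h_i(z_i), so that lower semicontinuity of h_i is enough to
  -- pass to the limit.
  refine le_of_tendsto_of_lowerSemicontinuous (hP.h_pcc i).closed (hzi i)
    (c := fun j => P.f i v + (P.h i v).toReal - P.f i (R.z (φ j) i)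
      - inner ℝ (R.lam (φ j)) (P.mulA i (R.z (φ j) i - v))
      - par.ρ * inner ℝ (P.mulA i (R.z (φ j) i) - P.blockRhs i (R.z (φ j)) (R.y (φ j)))
          (P.mulA i (R.z (φ j) i - v)) + 1 / 2 * g (φ j)) ?_ ?_
  · have := (((hf.const_sub (P.f i v + (P.h i v).toReal)).sub (hlam.inner hAv)).sub
      ((hrhs.inner hAv).const_mul par.ρ)).add ((hg.comp hφt).const_mul (1 / 2))
    simpa using this
  · filter_upwards [hφt.eventually_ge_atTop 1] with j hj
    rw [← (hP.h_pcc i).coe_toReal (hξ.z_mem_dom hP hj i), EReal.coe_le_coe_iff]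
    have h1 := hξ.block_estimate hP hj hv
    have h2 := hgle _ hj
    have h3 := mul_nonneg par.σ_mem.1.le (R.r_nonneg hj i)
    linarith

end Normalized

end AcceleratedRun

/-! ### Convergence of the whole sequence. -/

namespace AcceleratedRun.Normalized

variable {m N : ℕ} {n : Fin (m + 1) → ℕ} {P : Problem m N n} {par : Params} {ψ : ℝ≥0∞ → ℝ≥0∞}
  {R : AcceleratedRun P par ψ}

/-- If a subsequence converges to a solution/multiplier pair, then the energy relative to that
pair tends to zero. -/
theorem tendsto_energy (hξ : R.Normalized) (hP : P.Standing) (hψ : IsTolerance ψ) {κ : ℝ}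
    (hκ : 0 < κ)
    (hκγ : ∀ k, 1 ≤ k → ∀ i, ∀ l, 1 ≤ l → κ ≤ (R.loop k i).γ l * (R.loop k i).α l ^ 2)
    {xs : Blocks n} {lams : EuclideanSpace ℝ (Fin N)}
    (hs : (xs, lams) ∈ P.solutionMultiplierPairs) {φ : ℕ → ℕ} (hφ : StrictMono φ)
    (hz : Tendsto (fun j => R.z (φ j)) atTop (𝓝 xs))
    (hlam : Tendsto (fun j => R.lam (φ j)) atTop (𝓝 lams)) :
    Tendsto (fun k => R.energy xs lams (R.Γ k) k) atTop (𝓝 0) := by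
  have hφt := hφ.tendsto_atTop
  have hzi : ∀ i, Tendsto (fun j => R.z (φ j) i - xs i) atTop (𝓝 0) := fun i => by
    simpa using (tendsto_pi_nhds.1 hz i).sub_const (xs i)
  have hlam1 : Tendsto (fun j => R.lam (φ j) - lams) atTop (𝓝 0) := by
    simpa using hlam.sub_const lams
  have hplus : Tendsto (fun j => plus (R.y (φ j) - xs)) atTop (𝓝 0) := by
    refine tendsto_plus_zero fun i => ?_
    have := (hzi i.succ).sub ((hξ.tendsto_z_sub_y_succ hP hs i).comp hφt)
    rw [sub_zero] at this
    refine this.congr fun j => ?_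
    simp
  have hx : ∀ i, Tendsto (fun j => (R.Γ (φ j) i)⁻¹ * ‖xs i - R.x (φ j) i‖ ^ 2) atTop (𝓝 0) := by
    intro i
    have h1 := (hξ.tendsto_x_sub_z hP hs hψ hκ hκγ i).comp hφt
    have h2 := (hξ.tendsto_x_succ_sub_x hP hs hψ hκ hκγ i).comp hφt
    have h3 := ((hzi i).norm.pow 2).const_mul (R.Γ 1 i)⁻¹
    simp only [norm_zero, ne_eq, OfNat.ofNat_ne_zero, not_false_eq_true, zero_pow, mul_zero] at h3
    have h4 := ((h1.add h2).add h3).const_mul 3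
    simp only [add_zero, mul_zero] at h4
    refine squeeze_zero' ((hφt.eventually_ge_atTop 1).mono fun j hj =>
      mul_nonneg (inv_nonneg.2 (R.Γ_pos hj i).le) (sq_nonneg _))
      ((hφt.eventually_ge_atTop 1).mono fun j hj => ?_) h4
    have hG := inv_nonneg.2 (R.Γ_pos hj i).le
    -- The energy contains x^k while the subsequence is known to converge for z^k, so the path to
    -- x^k runs through z^k and x^{k+1}.
    have e1 := norm_add_add_sq_le (xs i - R.z (φ j) i) (R.z (φ j) i - R.x (φ j + 1) i)
      (R.x (φ j + 1) i - R.x (φ j) i)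
    rw [sub_add_sub_cancel, sub_add_sub_cancel, norm_sub_rev (R.z (φ j) i),
      norm_sub_rev (xs i) (R.z (φ j) i)] at e1
    have e2 := mul_le_mul_of_nonneg_left e1 hG
    have e3 := mul_le_mul_of_nonneg_right (R.inv_Γ_le_one hj i)
      (sq_nonneg ‖R.z (φ j) i - xs i‖)
    simp only [Function.comp_apply]
    linarith
  have hen : Tendsto (fun j => R.energy xs lams (R.Γ (φ j)) (φ j)) atTop (𝓝 0) := by
    have hc : Continuous fun v => v ⬝ᵥ P.weight *ᵥ v := by fun_prop
    have h1 := (hlam1.norm.pow 2).const_mul par.ρ⁻¹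
    have h2 := ((hc.tendsto 0).comp hplus).const_mul par.ρ
    have h3 := (tendsto_finsetSum Finset.univ fun i _ => hx i).const_mul par.α
    simpa [energy, Function.comp_def] using (h1.add h2).add h3
  -- The energy is nonincreasing, so one small value bounds all later ones.
  rw [Metric.tendsto_atTop]
  intro ε hε
  obtain ⟨j, hj, hj1⟩ :=
    ((hen.eventually (gt_mem_nhds hε)).and (hφt.eventually_ge_atTop 1)).exists
  refine ⟨φ j, fun k hk => ?_⟩
  rw [Real.dist_0_eq_abs, abs_of_nonneg (R.energy_nonneg xs lams hP (hj1.trans hk) k)]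
  exact (hξ.energy_le hP hs hj1 hk).trans_lt hj

/-- The energy controls λ and y₊ directly. Then z₊ follows from z − y → 0, and the first block of z
from the residual, as the weights on x may vanish. -/
theorem tendsto_of_energy (hξ : R.Normalized) (hP : P.Standing)
    {xs : Blocks n} {lams : EuclideanSpace ℝ (Fin N)}
    (hs : (xs, lams) ∈ P.solutionMultiplierPairs)
    (hen : Tendsto (fun k => R.energy xs lams (R.Γ k) k) atTop (𝓝 0)) :
    Tendsto R.y atTop (𝓝 xs) ∧ Tendsto R.z atTop (𝓝 xs) ∧ Tendsto R.lam atTop (𝓝 lams) := by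
  have hlam : Tendsto R.lam atTop (𝓝 lams) := by
    rw [tendsto_iff_norm_sub_tendsto_zero]
    have h1 := hen.const_mul par.ρ
    rw [mul_zero] at h1
    exact tendsto_zero_of_sq (squeeze_zero' (Eventually.of_forall fun k => sq_nonneg _)
      ((eventually_ge_atTop 1).mono fun k hk => R.norm_lam_sq_le xs lams hP hk) h1)
  have hplus : Tendsto (fun k => plus (R.y k - xs)) atTop (𝓝 0) := by
    obtain ⟨C, hC, hb⟩ := exists_sq_le_of_posDef hP.weight_posDef
    rw [tendsto_pi_nhds]
    intro p
    have h1 := (hen.const_mul par.ρ⁻¹).const_mul C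
    simp only [mul_zero] at h1
    exact tendsto_zero_of_sq (squeeze_zero' (Eventually.of_forall fun k => sq_nonneg _)
      ((eventually_ge_atTop 1).mono fun k hk =>
        (hb _ p).trans (mul_le_mul_of_nonneg_left (R.weight_le xs lams hP hk) hC.le)) h1)
  have hz : ∀ i, Tendsto (fun k => R.z k i - xs i) atTop (𝓝 0) := by
    have hr : P.residual xs = 0 := hs.1.1
    refine fun i => hP.tendsto_of_residual (u := R.z) (v := fun _ => xs) ?_ (fun j => ?_) i
    · simpa [hr] using hξ.tendsto_residual hP hs
    · have := (hξ.tendsto_z_sub_y_succ hP hs j).add (tendsto_of_tendsto_plus_zero hplus j)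
      rw [add_zero] at this
      refine this.congr fun k => ?_
      simp
  have hz' : ∀ i, Tendsto (fun k => R.z k i) atTop (𝓝 (xs i)) := fun i => by
    simpa using (hz i).add_const (xs i)
  refine ⟨tendsto_pi_nhds.2 fun i => ?_, tendsto_pi_nhds.2 hz', hlam⟩
  simpa using (hz' i).sub (hξ.tendsto_z_sub_y hP hs i)

end AcceleratedRun.Normalized

end BOSVS

end

theorem theorem5p4 {m N : ℕ} {n : Fin (m + 1) → ℕ} (P : BOSVS.Problem m N n)
    (hP : P.Standing) (hW : P.solutionMultiplierPairs.Nonempty)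
    (par : BOSVS.Params) (ψ : ℝ≥0∞ → ℝ≥0∞) (hψ : BOSVS.IsTolerance ψ)
    (R : BOSVS.AcceleratedRun P par ψ)
    (hξ : ∀ k, 1 ≤ k → ∀ i, ∀ l, 1 ≤ l →
      (R.loop k i).δ l * (R.loop k i).α l * (R.loop k i).γ l = 1)
    (hγ : ∀ k, 1 ≤ k → ∀ i, Tendsto (R.loop k i).γ atTop atTop)
    (hκ : ∃ κ : ℝ, 0 < κ ∧ ∀ k, 1 ≤ k → ∀ i, ∀ l, 1 ≤ l →
      κ ≤ (R.loop k i).γ l * (R.loop k i).α l ^ 2) :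
    ∃ (xs : BOSVS.Blocks n) (lams : EuclideanSpace ℝ (Fin N)),
      (xs, lams) ∈ P.solutionMultiplierPairs ∧
      Tendsto R.y atTop (𝓝 xs) ∧ Tendsto R.z atTop (𝓝 xs) ∧
      Tendsto R.lam atTop (𝓝 lams) := by
  obtain ⟨⟨x₀, lam₀⟩, hs⟩ := hW
  obtain ⟨κ, hκ0, hκγ⟩ := hκ
  have hN : R.Normalized := hξ
  -- The given pair serves only to produce a cluster point and show that it lies in W*; that cluster
  -- point then replaces it as reference.
  obtain ⟨xs, lams, φ, hφ, hz, hlam⟩ := hN.exists_cluster hP hs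
  have hmem := hN.cluster_mem hP hs hψ hκ0 hκγ hφ hz hlam
  exact ⟨xs, lams, hmem, hN.tendsto_of_energy hP hmem
    (hN.tendsto_energy hP hψ hκ0 hκγ hmem hφ hz hlam)⟩
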